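/- Let $G=(V,E)$ be an infinite, connected, simple graph with bounded maximum degree that is quasi-transitive, i.e. $V$ can be partitioned into finitely many classes such that any two vertices of the same class are mapped to each other by some automorphism of $G$. Given an initial profile $\eta_0\in\mathbb{R}^V$, a move consists of an edge $\langle x,y\rangle\in E$ and a number $\mu\in(0,\tfrac12]$; it replaces the levels $a$ at $x$ and $b$ at $y$ by $a+\mu(b-a)$ and $b+\mu(a-b)$ respectively and leaves all other levels unchanged. For $v\in V$, let $\kappa_G(v)$ be the supremum of all $r\ge 0$ such that some finite (possibly empty) sequence of moves, started from $\eta_0$, produces the level $r$ at $v$. Let the initial levels $(\eta_0(u))_{u\in V}$ be i.i.d. random variables with the uniform distribution on $(0,1)$. Then, for every vertex $v\in V$, the random variable $\kappa_G(v)$ fails to be almost surely constant if and only if $G$ is isomorphic to the two-sided infinite path, i.e. to the graph with vertex set $\mathbb{Z}$ and edges $\langle u,u+1\rangle$, $u\in\mathbb{Z}$. (The two-sided infinite path itself is an infinite, connected, quasi-transitive graph with bounded degree, so that it is the only such graph, up to isomorphism, for which $\kappa_G(v)$ is not deterministic.) -/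

import Mathlib

namespace WaterTransport

/-- A single move: an edge `⟨x, y⟩` of `G` together with a transferred fraction `μ ∈ (0, 1/2]`.
(The effect of a move, `Move.apply`, does not depend on the order of the two end points.) -/
structure Move {V : Type*} (G : SimpleGraph V) where
  x : V
  y : V
  adj : G.Adj x y
  μ : ℝ
  μ_pos : 0 < μ
  μ_le : μ ≤ 1 / 2

open Classical in
/-- The update rule: levels `a` at `x` and `b` at `y` become `a + μ (b - a)` and `b + μ (a - b)`;
all other levels stay unchanged. -/
noncomputable def Move.apply {V : Type*} {G : SimpleGraph V} (m : Move G) (η : V → ℝ) : V → ℝ :=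
  fun w =>
    if w = m.x then η m.x + m.μ * (η m.y - η m.x)
    else if w = m.y then η m.y + m.μ * (η m.x - η m.y)
    else η w

/-- The final water profile after performing a finite sequence of moves, in chronological order,
starting from the initial profile `η`. -/
noncomputable def finalProfile {V : Type*} {G : SimpleGraph V} (η : V → ℝ) (ms : List (Move G)) :
    V → ℝ :=
  ms.foldl (fun ζ m => m.apply ζ) η

/-- `κ_G(v)`: the supremum of all water levels `r ≥ 0` achievable at `v` by finite move sequences,
for the initial profile `η`. (For a profile with values in `[0, 1]` the set is nonempty and
bounded above by `1`.) -/
noncomputable def kappa {V : Type*} (G : SimpleGraph V) (η : V → ℝ) (v : V) : ℝ :=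
  sSup {r : ℝ | 0 ≤ r ∧ ∃ ms : List (Move G), finalProfile η ms v = r}

/-- The vertex set can be partitioned into finitely many classes such that any two vertices of the
same class are mapped to each other by a graph automorphism. -/
def IsQuasiTransitive {V : Type*} (G : SimpleGraph V) : Prop :=
  ∃ (n : ℕ) (c : V → Fin n), ∀ u w : V, c u = c w → ∃ f : G ≃g G, f u = w

/-- The vertex degrees are finite and uniformly bounded. -/
def HasBoundedDegree {V : Type*} (G : SimpleGraph V) : Prop :=
  ∃ D : ℕ, ∀ v : V, (G.neighborSet v).encard ≤ D

/-- The two-sided infinite path: vertex set `ℤ`, edges `⟨u, u + 1⟩` for `u ∈ ℤ`. -/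
def intPath : SimpleGraph ℤ where
  Adj u w := w = u + 1 ∨ u = w + 1
  symm := ⟨fun _ _ h => h.symm⟩
  loopless := ⟨fun u h => by omega⟩

end WaterTransport

/-! Suppose first that some vertex has three neighbours. Quasi-transitivity puts such branching
vertices within bounded distance of every vertex, so a geodesic ray from `v` has distinct side
neighbours of positive density: the `j`-th is attached among the first `M * (j + 1)` ray vertices
(`exists_side_neighbors`). If a side neighbour of a stretch of `N` ray vertices has level at least
`a`, half of its surplus, spread over the levelled stretch, multiplies the deficit below `a` by `1 -
1 / (2 * N)` (`exists_attainable_side`). Almost surely a positive proportion of the side neighbours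
has level at least `a`, and the harmonic series over a set of positive density diverges, so the
deficit at `v` can be made arbitrarily small. As `a < 1` is arbitrary, `kappa` is almost surely `1`
(`ae_kappa_eq_one`).

If no vertex branches, a leaf would recur within bounded distance of every vertex, contradicting the
long unbranched stretch of a ray. Hence the graph is 2-regular and is the two-sided path
(`nonempty_iso_intPath`).

On that path a duality is used: a move is a self-adjoint operator, so the final level at `0` is the
average of the initial profile against the weights got by running the moves in reverse on a unit
mass at `0`. These weights stay unimodal and have height at most `1 / (d + 1)` at distance `d`
(`exists_weights`). If the maximal weight is small, the law of large numbers keeps the average away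
from `1`; if it is large, the mode lies in a bounded window, and the deficit `1 - η` there carries a
definite weight (`exists_finalProfile_le`). So `kappa < 1` almost surely. Since `kappa` dominates
the initial level at `v`, which exceeds any constant below `1` with positive probability, it is not
almost surely constant. -/

namespace WaterTransport

/-! ### Algebra of a single move and elementary bounds. -/

open Classical in
theorem Move.apply_apply {V : Type*} {G : SimpleGraph V} (m : Move G) (η : V → ℝ) (w : V) :
    m.apply η w = η w + m.μ * (η m.y - η m.x) *
      ((if w = m.x then 1 else 0) - (if w = m.y then 1 else 0)) := by
  have hxy : m.x ≠ m.y := m.adj.ne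
  unfold Move.apply
  by_cases h1 : w = m.x
  · subst h1; simp [hxy]
  · by_cases h2 : w = m.y
    · subst h2; simp [h1]; ring
    · simp [h1, h2]

theorem Move.apply_of_ne {V : Type*} {G : SimpleGraph V} (m : Move G) (η : V → ℝ) {w : V}
    (hx : w ≠ m.x) (hy : w ≠ m.y) : m.apply η w = η w := by
  simp [Move.apply, hx, hy]

theorem Move.continuous_apply {V : Type*} {G : SimpleGraph V} (m : Move G) :
    Continuous m.apply := by
  classical
  refine continuous_pi fun w => ?_
  simp only [Move.apply_apply]
  fun_prop

theorem Move.apply_mem_Icc {V : Type*} {G : SimpleGraph V} (m : Move G) {η : V → ℝ}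
    (h : ∀ w, η w ∈ Set.Icc (0 : ℝ) 1) (w : V) : m.apply η w ∈ Set.Icc (0 : ℝ) 1 := by
  have hx := h m.x
  have hy := h m.y
  have h0 := m.μ_pos
  have h1 := m.μ_le
  simp only [Set.mem_Icc] at *
  unfold Move.apply
  split_ifs
  · constructor <;> nlinarith
  · constructor <;> nlinarith
  · exact h w

/-- The correction term is symmetric in `η` and `φ`, so a move is self-adjoint; this drives the
duality in `exists_weights`. The choice `φ = 1` gives conservation of mass. -/
theorem Move.sum_apply {V : Type*} {G : SimpleGraph V} (m : Move G) (η φ : V → ℝ)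
    {s : Finset V} (hx : m.x ∈ s) (hy : m.y ∈ s) :
    ∑ w ∈ s, φ w * m.apply η w =
      ∑ w ∈ s, φ w * η w + m.μ * (η m.y - η m.x) * (φ m.x - φ m.y) := by
  classical
  have (w : V) : φ w * m.apply η w = φ w * η w + m.μ * (η m.y - η m.x) *
      ((if w = m.x then φ w else 0) - (if w = m.y then φ w else 0)) := by
    rw [Move.apply_apply]; split_ifs <;> ring
  simp only [this, Finset.sum_add_distrib, ← Finset.mul_sum, Finset.sum_sub_distrib,
    Finset.sum_ite_eq', hx, hy, if_true]

/-- The sum of squares serves as an energy: it strictly drops whenever a move crosses an edge with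
unequal levels. -/
theorem Move.sum_apply_sq {V : Type*} {G : SimpleGraph V} (m : Move G) (η : V → ℝ)
    {s : Finset V} (hx : m.x ∈ s) (hy : m.y ∈ s) :
    ∑ w ∈ s, m.apply η w ^ 2 =
      ∑ w ∈ s, η w ^ 2 - 2 * m.μ * (1 - m.μ) * (η m.y - η m.x) ^ 2 := by
  classical
  have hxy : m.x ≠ m.y := m.adj.ne
  have (w : V) : m.apply η w ^ 2 = η w ^ 2 +
      ((if w = m.x then 2 * η w * (m.μ * (η m.y - η m.x)) + (m.μ * (η m.y - η m.x)) ^ 2 else 0) +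
      (if w = m.y then
        - (2 * η w * (m.μ * (η m.y - η m.x))) + (m.μ * (η m.y - η m.x)) ^ 2 else 0)) := by
    rw [Move.apply_apply]
    by_cases h1 : w = m.x
    · have h2 : w ≠ m.y := h1 ▸ hxy
      simp only [if_pos h1, if_neg h2]; ring
    · by_cases h2 : w = m.y
      · simp only [if_neg h1, if_pos h2]; ring
      · simp only [if_neg h1, if_neg h2]; ring
  simp only [this, Finset.sum_add_distrib, Finset.sum_ite_eq', hx, hy, if_true]
  ring

theorem finalProfile_mem_Icc {V : Type*} {G : SimpleGraph V} (ms : List (Move G)) {η : V → ℝ}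
    (h : ∀ w, η w ∈ Set.Icc (0 : ℝ) 1) (w : V) :
    finalProfile η ms w ∈ Set.Icc (0 : ℝ) 1 := by
  induction ms generalizing η with
  | nil => exact h w
  | cons m ms ih => exact ih (m.apply_mem_Icc h)

theorem bddAbove_levels {V : Type*} (G : SimpleGraph V) {η : V → ℝ}
    (h : ∀ w, η w ∈ Set.Icc (0 : ℝ) 1) (v : V) :
    BddAbove {r : ℝ | 0 ≤ r ∧ ∃ ms : List (Move G), finalProfile η ms v = r} :=
  ⟨1, by rintro r ⟨-, ms, rfl⟩; exact (finalProfile_mem_Icc ms h v).2⟩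

theorem finalProfile_le_kappa {V : Type*} {G : SimpleGraph V} {η : V → ℝ}
    (h : ∀ w, η w ∈ Set.Icc (0 : ℝ) 1) (v : V) (ms : List (Move G)) :
    finalProfile η ms v ≤ kappa G η v :=
  le_csSup (bddAbove_levels G h v) ⟨(finalProfile_mem_Icc ms h v).1, ms, rfl⟩

theorem kappa_le {V : Type*} {G : SimpleGraph V} {η : V → ℝ} {v : V} (h : 0 ≤ η v) {c : ℝ}
    (hc : ∀ ms : List (Move G), finalProfile η ms v ≤ c) : kappa G η v ≤ c :=
  csSup_le ⟨η v, h, [], rfl⟩ (by rintro r ⟨-, ms, rfl⟩; exact hc ms)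

/-! ### Limits of finite move sequences. -/

/-- The profiles that can be approximated pointwise by finite sequences of moves inside `S`. -/
def Attainable {V : Type*} (G : SimpleGraph V) (S : Set V) (η ζ : V → ℝ) : Prop :=
  ζ ∈ closure {ζ : V → ℝ | ∃ ms : List (Move G), (∀ m ∈ ms, m.x ∈ S ∧ m.y ∈ S) ∧ finalProfile η ms = ζ}

theorem self_mem_attainable {V : Type*} (G : SimpleGraph V) (S : Set V) (η : V → ℝ) :
    Attainable G S η η :=
  subset_closure ⟨[], by simp, rfl⟩

theorem Attainable.apply_mem {V : Type*} {G : SimpleGraph V} {S : Set V} {η ζ : V → ℝ}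
    (h : Attainable G S η ζ) (m : Move G) (hx : m.x ∈ S) (hy : m.y ∈ S) :
    Attainable G S η (m.apply ζ) := by
  refine map_mem_closure m.continuous_apply h ?_
  rintro _ ⟨ms, hms, rfl⟩
  refine ⟨ms ++ [m], ?_, by simp [finalProfile]⟩
  intro m' hm'
  rcases List.mem_append.1 hm' with h | h
  · exact hms m' h
  · rw [List.mem_singleton.1 h]; exact ⟨hx, hy⟩

theorem Attainable.trans {V : Type*} {G : SimpleGraph V} {S T : Set V} {η ζ ξ : V → ℝ}
    (h : Attainable G T η ζ) (hST : S ⊆ T) (h' : Attainable G S ζ ξ) :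
    Attainable G T η ξ := by
  refine closure_minimal ?_ isClosed_closure h'
  rintro _ ⟨ms, hms, rfl⟩
  clear h'
  induction ms generalizing ζ with
  | nil => exact h
  | cons m ms ih =>
    have hm := hms m (by simp)
    have h1 := h.apply_mem m (hST hm.1) (hST hm.2)
    exact ih h1 fun m' hm' => hms m' (by simp [hm'])

/-- A closed property of profiles that is preserved by all moves inside `S` passes on to the
attainable profiles. -/
theorem Attainable.induction {V : Type*} {G : SimpleGraph V} {S : Set V} {η : V → ℝ}
    {p : (V → ℝ) → Prop} (hp : IsClosed {ζ | p ζ})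
    (hm : ∀ (m : Move G) (ζ : V → ℝ), m.x ∈ S → m.y ∈ S → p ζ → p (m.apply ζ))
    (h0 : p η) {ζ : V → ℝ} (h : Attainable G S η ζ) : p ζ := by
  suffices closure _ ⊆ {ζ | p ζ} from this h
  refine closure_minimal ?_ hp
  rintro _ ⟨ms, hms, rfl⟩
  clear h
  induction ms generalizing η with
  | nil => exact h0
  | cons m ms ih =>
    have := hms m (by simp)
    exact ih (hm m η this.1 this.2 h0) fun m' hm' => hms m' (by simp [hm'])

theorem Attainable.mem_Icc {V : Type*} {G : SimpleGraph V} {S : Set V} {η ζ : V → ℝ}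
    (h : Attainable G S η ζ) (hη : ∀ w, η w ∈ Set.Icc (0 : ℝ) 1) :
    ∀ w, ζ w ∈ Set.Icc (0 : ℝ) 1 := by
  refine h.induction (p := fun ζ => ∀ w, ζ w ∈ Set.Icc (0 : ℝ) 1) ?_
    (fun m ζ _ _ hζ => m.apply_mem_Icc hζ) hη
  simp only [Set.ofPred_forall]
  exact isClosed_iInter fun w => isClosed_Icc.preimage (continuous_apply w)

theorem Attainable.eq_of_notMem {V : Type*} {G : SimpleGraph V} {S : Set V} {η ζ : V → ℝ}
    (h : Attainable G S η ζ) {w : V} (hw : w ∉ S) : ζ w = η w := by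
  refine h.induction (p := fun ζ => ζ w = η w)
    (isClosed_eq (continuous_apply w) continuous_const) (fun m ζ hx hy hζ => ?_) rfl
  rw [m.apply_of_ne ζ (by rintro rfl; exact hw hx) (by rintro rfl; exact hw hy), hζ]

theorem Attainable.sum_eq {V : Type*} {G : SimpleGraph V} {s : Finset V} {η ζ : V → ℝ}
    (h : Attainable G s η ζ) : ∑ w ∈ s, ζ w = ∑ w ∈ s, η w := by
  refine h.induction (p := fun ζ => ∑ w ∈ s, ζ w = ∑ w ∈ s, η w)
    (isClosed_eq (by fun_prop) continuous_const) (fun m ζ hx hy hζ => ?_) rfl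
  have := m.sum_apply ζ (fun _ => 1) hx hy
  simp only [one_mul, sub_self, mul_zero, add_zero] at this
  rw [this, hζ]

theorem Attainable.le_kappa {V : Type*} {G : SimpleGraph V} {S : Set V} {η ζ : V → ℝ}
    (h : Attainable G S η ζ) (hη : ∀ w, η w ∈ Set.Icc (0 : ℝ) 1) (v : V) :
    ζ v ≤ kappa G η v := by
  suffices closure _ ⊆ {ζ : V → ℝ | ζ v ≤ kappa G η v} from this h
  refine closure_minimal ?_ (isClosed_le (continuous_apply v) continuous_const)
  rintro _ ⟨ms, -, rfl⟩
  exact finalProfile_le_kappa hη v ms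

/-! ### Levelling on finite sets and along rays. -/

/-- Water can be levelled out completely on a finite connected set. -/
theorem exists_attainable_const {V : Type*} {G : SimpleGraph V} {s : Finset V}
    (hs : ∀ ζ : V → ℝ, (∀ x ∈ s, ∀ y ∈ s, G.Adj x y → ζ x = ζ y) →
      ∀ x ∈ s, ∀ y ∈ s, ζ x = ζ y)
    {η : V → ℝ} (hη : ∀ w, η w ∈ Set.Icc (0 : ℝ) 1) :
    ∃ ζ, Attainable G s η ζ ∧ ∀ x ∈ s, s.card * ζ x = ∑ w ∈ s, η w := by
  have hcomp : IsCompact {ζ | Attainable G s η ζ} := by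
    refine (isCompact_univ_pi fun _ : V => isCompact_Icc (a := (0 : ℝ)) (b := 1)).of_isClosed_subset
      isClosed_closure ?_
    intro ζ hζ w _
    exact Attainable.mem_Icc hζ hη w
  -- An energy minimiser must agree across every edge inside `s`, since a move with `μ = 1 / 2`
  -- would otherwise lower the energy.
  obtain ⟨ζ, hζ, hmin⟩ := hcomp.exists_isMinOn ⟨η, self_mem_attainable G s η⟩
    (f := fun ζ : V → ℝ => ∑ w ∈ s, ζ w ^ 2) (by fun_prop)
  refine ⟨ζ, hζ, fun x hx => ?_⟩
  have hconst := hs ζ fun x hx y hy hxy => by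
    by_contra hne
    let m : Move G := ⟨x, y, hxy, 1 / 2, by norm_num, le_rfl⟩
    have h1 := hmin (Attainable.apply_mem hζ m hx hy)
    simp only [Set.mem_ofPred_eq, m.sum_apply_sq ζ hx hy] at h1
    have : 0 < (ζ y - ζ x) ^ 2 := by
      have : ζ y - ζ x ≠ 0 := sub_ne_zero.2 (Ne.symm hne)
      positivity
    simp only [m] at h1
    linarith
  rw [← Attainable.sum_eq hζ, Finset.sum_congr rfl fun y hy => hconst y hy x hx]
  simp

theorem exists_attainable_const_path {V : Type*} {G : SimpleGraph V} {r : ℕ → V}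
    (hinj : Function.Injective r) (hadj : ∀ n, G.Adj (r n) (r (n + 1))) (N : ℕ)
    {η : V → ℝ} (hη : ∀ w, η w ∈ Set.Icc (0 : ℝ) 1) :
    ∃ ζ, Attainable G (r '' Set.Iio N) η ζ ∧
      ∀ k < N, N * ζ (r k) = ∑ j ∈ Finset.range N, η (r j) := by
  have hs : ∀ ζ : V → ℝ, (∀ x ∈ (Finset.range N).map ⟨r, hinj⟩,
      ∀ y ∈ (Finset.range N).map ⟨r, hinj⟩, G.Adj x y → ζ x = ζ y) →
      ∀ x ∈ (Finset.range N).map ⟨r, hinj⟩, ∀ y ∈ (Finset.range N).map ⟨r, hinj⟩,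
      ζ x = ζ y := by
    intro ζ h
    have key : ∀ k < N, ζ (r k) = ζ (r 0) := by
      intro k
      induction k with
      | zero => simp
      | succ k ih =>
        intro hk
        rw [← ih (by omega)]
        exact (h _ (by simp; omega) _ (by simp; omega) (hadj k)).symm
    simp only [Finset.mem_map, Finset.mem_range, Function.Embedding.coeFn_mk]
    rintro _ ⟨a, ha, rfl⟩ _ ⟨b, hb, rfl⟩
    rw [key a ha, key b hb]
  obtain ⟨ζ, hζ, h⟩ := exists_attainable_const hs hη
  refine ⟨ζ, ?_, fun k hk => ?_⟩
  · convert hζ using 1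
    ext x; simp
  · simpa using h (r k) (by simpa using hk)

/-- Adding half of the surplus of one side neighbour to a path and levelling out. -/
theorem exists_attainable_side {V : Type*} {G : SimpleGraph V} {r : ℕ → V}
    (hinj : Function.Injective r) (hadj : ∀ n, G.Adj (r n) (r (n + 1))) {N k : ℕ} (hk : k < N)
    {u : V} (hu : u ∉ Set.range r) (huk : G.Adj (r k) u)
    {η : V → ℝ} (hη : ∀ w, η w ∈ Set.Icc (0 : ℝ) 1) {a D : ℝ}
    (hD : ∀ i < N, a - D ≤ η (r i)) (ha : a ≤ η u) :
    ∃ ζ, Attainable G (r '' Set.Iio N ∪ {u}) η ζ ∧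
      ∀ i < N, a - D * (1 - 1 / (2 * N)) ≤ ζ (r i) := by
  have hN : (0 : ℝ) < N := by exact_mod_cast (by omega : 0 < N)
  obtain ⟨ζ₁, h₁, hc₁⟩ := exists_attainable_const_path hinj hadj N hη
  have hL : ∀ i < N, ζ₁ (r i) = ζ₁ (r k) := fun i hi =>
    mul_left_cancel₀ hN.ne' ((hc₁ i hi).trans (hc₁ k hk).symm)
  have hLD : a - D ≤ ζ₁ (r k) := by
    have : ∑ j ∈ Finset.range N, (a - D) ≤ ∑ j ∈ Finset.range N, η (r j) :=
      Finset.sum_le_sum fun i hi => hD i (Finset.mem_range.1 hi)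
    rw [← hc₁ k hk, Finset.sum_const, Finset.card_range, nsmul_eq_mul] at this
    exact le_of_mul_le_mul_left this hN
  have hu₁ : ζ₁ u = η u := Attainable.eq_of_notMem h₁ (by rintro ⟨i, -, rfl⟩; exact hu ⟨i, rfl⟩)
  let m : Move G := ⟨r k, u, huk, 1 / 2, by norm_num, le_rfl⟩
  have h₁' : Attainable G (r '' Set.Iio N ∪ {u}) η ζ₁ :=
    (self_mem_attainable G _ η).trans Set.subset_union_left h₁
  have h₂ := h₁'.apply_mem m (Or.inl ⟨k, hk, rfl⟩) (Or.inr rfl)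
  obtain ⟨ζ₃, h₃, hc₃⟩ := exists_attainable_const_path hinj hadj N (h₂.mem_Icc hη)
  refine ⟨ζ₃, h₂.trans Set.subset_union_left h₃, fun i hi => ?_⟩
  have hsum : ∑ j ∈ Finset.range N, m.apply ζ₁ (r j) =
      N * ζ₁ (r k) + 1 / 2 * (η u - ζ₁ (r k)) := by
    classical
    have (j : ℕ) (hj : j ∈ Finset.range N) : m.apply ζ₁ (r j) =
        ζ₁ (r k) + if j = k then 1 / 2 * (η u - ζ₁ (r k)) else 0 := by
      have hne : r j ≠ u := fun e => hu ⟨j, e⟩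
      rw [Move.apply_apply, hL j (Finset.mem_range.1 hj)]
      simp only [m, hinj.eq_iff, hne, if_false, hu₁]
      split_ifs <;> ring
    rw [Finset.sum_congr rfl this, Finset.sum_add_distrib, Finset.sum_ite_eq']
    simp [hk]
  have h4 := hc₃ i hi
  rw [hsum] at h4
  -- The new common level is a convex combination of the old one and `η u`, with weight `1 / (2 *
  -- N)` on `η u`.
  have h5 : ζ₃ (r i) = ζ₁ (r k) + 1 / (2 * N) * (η u - ζ₁ (r k)) := by
    field_simp
    linarith
  have hw : 1 / (2 * (N : ℝ)) ≤ 1 / 2 := by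
    have : (1 : ℝ) ≤ N := by exact_mod_cast (by omega : 1 ≤ N)
    gcongr; linarith
  have hw0 : 0 < 1 / (2 * (N : ℝ)) := by positivity
  rw [h5]
  nlinarith

/-- The side neighbours are used in decreasing order of index: the longest stretch comes first, so
the improved bound covers the shorter stretches that follow. Being distinct and off the ray, each
side neighbour still has its initial level when its turn comes. -/
theorem exists_attainable_ray {V : Type*} {G : SimpleGraph V} {r : ℕ → V}
    (hinj : Function.Injective r) (hadj : ∀ n, G.Adj (r n) (r (n + 1))) {M : ℕ}
    {f : ℕ → ℕ} {u : ℕ → V} (hf : ∀ j, f j < M * (j + 1)) (hu : ∀ j, u j ∉ Set.range r)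
    (huinj : Function.Injective u) (hfu : ∀ j, G.Adj (r (f j)) (u j)) (a : ℝ) (J : Set ℕ)
    [DecidablePred (· ∈ J)] (n : ℕ) {η : V → ℝ} (hη : ∀ w, η w ∈ Set.Icc (0 : ℝ) 1)
    {D : ℝ} (hD : ∀ i < M * (n + 1), a - D ≤ η (r i)) (ha : ∀ j < n, j ∈ J → a ≤ η (u j)) :
    ∃ ζ, Attainable G Set.univ η ζ ∧
      a - D * ∏ j ∈ Finset.range n with j ∈ J, (1 - 1 / (2 * (M * (j + 1)) : ℝ)) ≤ ζ (r 0) := by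
  have hM : 0 < M := Nat.pos_of_ne_zero fun h => by have := hf 0; simp [h] at this
  induction n generalizing η D with
  | zero => exact ⟨η, self_mem_attainable _ _ _, by simpa using hD 0 (by simpa using hM)⟩
  | succ n ih =>
    have hle : M * (n + 1) ≤ M * (n + 1 + 1) := Nat.mul_le_mul_left _ (by omega)
    rw [Finset.range_add_one, Finset.filter_insert]
    by_cases hn : n ∈ J
    · obtain ⟨ζ, hζ, hb⟩ := exists_attainable_side hinj hadj (hf n) (hu n) (hfu n) hη
        (fun i hi => hD i (hi.trans_le hle)) (ha n (by omega) hn)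
      obtain ⟨ξ, hξ, hb'⟩ := ih (η := ζ) (hζ.mem_Icc hη) hb fun j hj hjJ => by
        rw [Attainable.eq_of_notMem hζ]
        · exact ha j (by omega) hjJ
        · rintro (⟨i, -, h⟩ | h)
          · exact hu j ⟨i, h⟩
          · exact hj.ne (huinj h)
      refine ⟨ξ, ((self_mem_attainable _ _ _).trans (Set.subset_univ _) hζ).trans le_rfl hξ, ?_⟩
      rw [if_pos hn, Finset.prod_insert (by simp), ← mul_assoc]
      push_cast at hb'
      exact hb'
    · rw [if_neg hn]
      exact ih hη (fun i hi => hD i (hi.trans_le hle)) fun j hj => ha j (by omega)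

/-! ### Distances, geodesic rays and quasi-transitivity. -/

theorem HasBoundedDegree.finite_neighborSet {V : Type*} {G : SimpleGraph V}
    (h : HasBoundedDegree G) (v : V) : (G.neighborSet v).Finite := by
  obtain ⟨D, hD⟩ := h
  exact Set.finite_of_encard_le_coe (hD v)

theorem exists_adj_dist_add_one {V : Type*} {G : SimpleGraph V} (hc : G.Connected) {x w : V}
    (h : w ≠ x) : ∃ y, G.Adj x y ∧ G.dist x w = G.dist y w + 1 := by
  obtain ⟨p, hp⟩ := hc.exists_walk_length_eq_dist x w
  cases p with
  | nil => exact absurd rfl h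
  | @cons _ y _ hxy q =>
    refine ⟨y, hxy, ?_⟩
    have h1 := G.dist_le q
    have h2 := hc.dist_triangle (u := x) (v := y) (w := w)
    rw [SimpleGraph.dist_eq_one_iff_adj.2 hxy] at h2
    simp only [SimpleGraph.Walk.length_cons] at hp
    omega

theorem finite_dist_le {V : Type*} {G : SimpleGraph V} (hc : G.Connected)
    (hf : ∀ v, (G.neighborSet v).Finite) (v : V) (n : ℕ) : {w | G.dist w v ≤ n}.Finite := by
  induction n with
  | zero =>
    refine (Set.finite_singleton v).subset fun w hw => ?_
    exact hc.dist_eq_zero_iff.1 (Nat.le_zero.1 hw)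
  | succ n ih =>
    refine ((ih.biUnion fun y _ => hf y).union (Set.finite_singleton v)).subset fun w hw => ?_
    by_cases hwv : w = v
    · exact Or.inr hwv
    · obtain ⟨y, hy, hd⟩ := exists_adj_dist_add_one hc (Ne.symm hwv)
      have hw' : G.dist w v ≤ n + 1 := hw
      exact Or.inl (Set.mem_biUnion (show y ∈ {w | G.dist w v ≤ n} by
        change G.dist y v ≤ n; omega) hy.symm)

theorem countable_of_connected {V : Type*} {G : SimpleGraph V} (hc : G.Connected)
    (hf : ∀ v, (G.neighborSet v).Finite) : Countable V := by
  obtain ⟨v⟩ := hc.nonempty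
  rw [← Set.countable_univ_iff]
  refine (Set.countable_iUnion fun n => (finite_dist_le hc hf v n).countable).mono fun w _ => ?_
  exact Set.mem_iUnion.2 ⟨G.dist w v, le_refl (G.dist w v)⟩

/-- Every vertex of an infinite, locally finite, connected graph is the starting point of a
geodesic ray. -/
theorem exists_geodesic_ray {V : Type*} [Infinite V] {G : SimpleGraph V} (hc : G.Connected)
    (hf : ∀ v, (G.neighborSet v).Finite) (v : V) :
    ∃ r : ℕ → V, r 0 = v ∧ (∀ n, G.Adj (r n) (r (n + 1))) ∧ ∀ n, G.dist v (r n) = n := by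
  -- König's argument: `P x` says that infinitely many vertices lie beyond `x` on geodesics from
  -- `v`. With finitely many neighbours, some next vertex inherits this.
  let P : V → Prop := fun x => {w | G.dist v w = G.dist v x + G.dist x w}.Infinite
  have hv : P v := by
    change Set.Infinite {w | G.dist v w = G.dist v v + G.dist v w}
    simpa using Set.infinite_univ
  have step : ∀ x, P x → ∃ y, G.Adj x y ∧ G.dist v y = G.dist v x + 1 ∧ P y := by
    intro x hx
    by_contra! hno
    refine hx (((((hf x).subset Set.inter_subset_left).biUnion
      (s := G.neighborSet x ∩ {y | G.dist v y = G.dist v x + 1}) fun y hy =>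
        Set.not_infinite.1 (hno y hy.1 hy.2)).union (Set.finite_singleton x)).subset fun w hw => ?_)
    by_cases hwx : w = x
    · exact Or.inr hwx
    · obtain ⟨y, hy, hd⟩ := exists_adj_dist_add_one hc hwx
      have h1 := hc.dist_triangle (u := v) (v := y) (w := w)
      have h2 := hc.dist_triangle (u := v) (v := x) (w := y)
      rw [SimpleGraph.dist_eq_one_iff_adj.2 hy] at h2
      have hw' : G.dist v w = G.dist v x + G.dist x w := hw
      have h3 : G.dist v y = G.dist v x + 1 := by omega
      refine Or.inl (Set.mem_biUnion (show y ∈ _ from ⟨hy, h3⟩) ?_)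
      change G.dist v w = G.dist v y + G.dist y w
      omega
  choose! nxt h1 h2 h3 using step
  let r : ℕ → V := fun n => nxt^[n] v
  have hr : ∀ n, r (n + 1) = nxt (r n) := fun n => Function.iterate_succ_apply' nxt n v
  have hP : ∀ n, P (r n) := by
    intro n
    induction n with
    | zero => exact hv
    | succ n ih => rw [hr]; exact h3 _ ih
  refine ⟨r, rfl, fun n => hr n ▸ h1 _ (hP n), fun n => ?_⟩
  induction n with
  | zero => exact SimpleGraph.dist_self
  | succ n ih => rw [hr, h2 _ (hP n), ih]

theorem injective_of_dist {V : Type*} {G : SimpleGraph V} {r : ℕ → V} {v : V}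
    (hd : ∀ n, G.dist v (r n) = n) : Function.Injective r := fun a b h => by
  rw [← hd a, ← hd b, h]

theorem le_dist_add_of_dist {V : Type*} {G : SimpleGraph V} (hc : G.Connected) {r : ℕ → V} {v : V}
    (hd : ∀ n, G.dist v (r n) = n) (a b : ℕ) : a ≤ b + G.dist (r b) (r a) := by
  have := hc.dist_triangle (u := v) (v := r b) (w := r a)
  rwa [hd, hd] at this

/-- In a quasi-transitive graph, a vertex property that is invariant under automorphisms and
satisfied somewhere is satisfied within bounded distance of every vertex. -/
theorem IsQuasiTransitive.exists_dist_le {V : Type*} {G : SimpleGraph V} (hq : IsQuasiTransitive G)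
    {B : V → Prop} (hB : ∀ (f : G ≃g G) (w : V), B w → B (f w)) {w₀ : V} (hw₀ : B w₀) :
    ∃ R : ℕ, ∀ x, ∃ w, B w ∧ G.dist x w ≤ R := by
  obtain ⟨n, c, hc⟩ := hq
  have key : ∀ i : Fin n, ∃ R : ℕ, ∀ x, c x = i → ∃ w, B w ∧ G.dist x w ≤ R := by
    intro i
    by_cases hi : ∃ y, c y = i
    · obtain ⟨y, hy⟩ := hi
      refine ⟨G.dist y w₀, fun x hx => ?_⟩
      obtain ⟨f, rfl⟩ := hc y x (hy.trans hx.symm)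
      refine ⟨f w₀, hB f w₀ hw₀, ?_⟩
      by_cases hr : G.Reachable y w₀
      · obtain ⟨p, hp⟩ := hr.exists_walk_length_eq_dist
        rw [← hp, ← SimpleGraph.Walk.length_map f.toHom p]
        exact G.dist_le _
      -- Between unreachable vertices `dist` takes the default value `0`, so connectedness need not
      -- be assumed.
      · rw [SimpleGraph.dist_eq_zero_of_not_reachable]
        · exact Nat.zero_le _
        · rwa [f.reachable_iff]
    · exact ⟨0, fun x hx => absurd ⟨x, hx⟩ hi⟩
  choose R hR using key
  refine ⟨Finset.univ.sup R, fun x => ?_⟩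
  obtain ⟨w, hw, hd⟩ := hR (c x) x rfl
  exact ⟨w, hw, hd.trans (Finset.le_sup (Finset.mem_univ _))⟩

/-- If a stretch of a geodesic ray has no side neighbours, then the corresponding ball is
contained in the ray. -/
theorem exists_eq_of_dist_le {V : Type*} {G : SimpleGraph V} (hc : G.Connected) {r : ℕ → V}
    {c R : ℕ} (hns : ∀ n, c ≤ n + R → n ≤ c + R → ∀ u, G.Adj (r n) u → ∃ i, u = r i ∧
      i ≤ n + 1 ∧ n ≤ i + 1) (k : ℕ) (hk : k ≤ R) {w : V} (hw : G.dist (r c) w = k) :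
    ∃ n, w = r n ∧ c ≤ n + k ∧ n ≤ c + k := by
  induction k generalizing w with
  | zero => exact ⟨c, (hc.dist_eq_zero_iff.1 hw).symm, by omega, by omega⟩
  | succ k ih =>
    have hne : r c ≠ w := fun h => by rw [h] at hw; simp at hw
    obtain ⟨y, hy, hd⟩ := exists_adj_dist_add_one hc hne
    have hk' : G.dist (r c) y = k := by
      rw [SimpleGraph.dist_comm (u := w), hw, SimpleGraph.dist_comm (u := y)] at hd; omega
    obtain ⟨n, rfl, h1, h2⟩ := ih (by omega) hk'
    obtain ⟨i, hi, h3, h4⟩ := hns n (by omega) (by omega) w hy.symm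
    exact ⟨i, hi, by omega, by omega⟩

/-! ### Branching vertices, and the graphs without them. -/

def IsBranching {V : Type*} (G : SimpleGraph V) (x : V) : Prop :=
  ∃ a b c, G.Adj x a ∧ G.Adj x b ∧ G.Adj x c ∧ a ≠ b ∧ a ≠ c ∧ b ≠ c

theorem IsBranching.map {V : Type*} {G : SimpleGraph V} (f : G ≃g G) {x : V}
    (h : IsBranching G x) : IsBranching G (f x) := by
  obtain ⟨a, b, c, ha, hb, hc, hab, hac, hbc⟩ := h
  exact ⟨f a, f b, f c, f.map_adj_iff.2 ha, f.map_adj_iff.2 hb, f.map_adj_iff.2 hc,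
    f.injective.ne hab, f.injective.ne hac, f.injective.ne hbc⟩

/-- If branching vertices are present everywhere, then the side neighbours of a geodesic ray have
positive density. -/
theorem exists_side_neighbors {V : Type*} {G : SimpleGraph V} (hc : G.Connected) {r : ℕ → V}
    {v : V} (hd : ∀ n, G.dist v (r n) = n) {R : ℕ}
    (hR : ∀ x, ∃ w, IsBranching G w ∧ G.dist x w ≤ R) :
    ∃ (M : ℕ) (f : ℕ → ℕ) (u : ℕ → V), (∀ j, f j < M * (j + 1)) ∧
      (∀ j, u j ∉ Set.range r) ∧ Function.Injective u ∧ ∀ j, G.Adj (r (f j)) (u j) := by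
  have hrange : ∀ n i, G.Adj (r n) (r i) → i ≤ n + 1 ∧ n ≤ i + 1 := by
    intro n i h
    have h1 := le_dist_add_of_dist hc hd n i
    have h2 := le_dist_add_of_dist hc hd i n
    rw [SimpleGraph.dist_eq_one_iff_adj.2 h] at h2
    rw [SimpleGraph.dist_eq_one_iff_adj.2 h.symm] at h1
    omega
  have key : ∀ c, ∃ n u, c ≤ n + R ∧ n ≤ c + R ∧ G.Adj (r n) u ∧ u ∉ Set.range r := by
    intro c
    by_contra! hno
    have hns : ∀ n, c ≤ n + R → n ≤ c + R → ∀ u, G.Adj (r n) u → ∃ i, u = r i ∧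
        i ≤ n + 1 ∧ n ≤ i + 1 := by
      intro n h1 h2 u hu
      obtain ⟨i, rfl⟩ := hno n u h1 h2 hu
      exact ⟨i, rfl, hrange n i hu⟩
    -- Without side neighbours near `r c`, the branching vertex found there is some `r n`, whose
    -- neighbours can only be `r (n - 1)` and `r (n + 1)`.
    obtain ⟨w, hw, hwR⟩ := hR (r c)
    obtain ⟨n, rfl, h1, h2⟩ := exists_eq_of_dist_le hc hns _ hwR rfl
    obtain ⟨x, y, z, hx, hy, hz, hxy, hxz, hyz⟩ := hw
    obtain ⟨i, rfl, hi, hi'⟩ := hns n (by omega) (by omega) x hx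
    obtain ⟨j, rfl, hj, hj'⟩ := hns n (by omega) (by omega) y hy
    obtain ⟨k, rfl, hk, hk'⟩ := hns n (by omega) (by omega) z hz
    have : i ≠ j := fun h => hxy (h ▸ rfl)
    have : i ≠ k := fun h => hxz (h ▸ rfl)
    have : j ≠ k := fun h => hyz (h ▸ rfl)
    have : i ≠ n := fun h => hx.ne (h ▸ rfl)
    have : j ≠ n := fun h => hy.ne (h ▸ rfl)
    have : k ≠ n := fun h => hz.ne (h ▸ rfl)
    omega
  -- Disjoint windows with a margin at the end: attachment points of different windows are more than
  -- `2` apart on the geodesic, so they cannot share a side neighbour.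
  have key' : ∀ j : ℕ, ∃ n u, (2 * R + 4) * j ≤ n ∧ n + 3 < (2 * R + 4) * (j + 1) ∧
      G.Adj (r n) u ∧ u ∉ Set.range r := by
    intro j
    obtain ⟨n, u, h1, h2, h⟩ := key ((2 * R + 4) * j + R)
    exact ⟨n, u, by omega, by rw [mul_add]; omega, h⟩
  choose f u h1 h2 h3 h4 using key'
  refine ⟨2 * R + 4, f, u, fun j => by have := h2 j; omega, h4, ?_, h3⟩
  refine .of_lt_imp_ne fun i j hij he => ?_
  have h5 : (2 * R + 4) * (i + 1) ≤ (2 * R + 4) * j := Nat.mul_le_mul_left _ hij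
  have h6 := le_dist_add_of_dist hc hd (f j) (f i)
  have h7 := hc.dist_triangle (u := r (f i)) (v := u i) (w := r (f j))
  rw [SimpleGraph.dist_eq_one_iff_adj.2 (h3 i), he,
    SimpleGraph.dist_eq_one_iff_adj.2 (h3 j).symm] at h7
  have := h2 i
  have := h1 j
  omega

/-- An infinite connected quasi-transitive graph without branching vertices is regular of
degree two. -/
theorem existsUnique_other_neighbor {V : Type*} [Infinite V] {G : SimpleGraph V}
    (hc : G.Connected) (hf : ∀ v, (G.neighborSet v).Finite) (hq : IsQuasiTransitive G)
    (hB : ∀ x, ¬ IsBranching G x) {x y : V} (h : G.Adj x y) :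
    ∃! z, z ≠ x ∧ G.Adj y z := by
  have huniq : ∀ z z', z ≠ x ∧ G.Adj y z → z' ≠ x ∧ G.Adj y z' → z = z' := by
    rintro z z' ⟨h1, h2⟩ ⟨h3, h4⟩
    by_contra hne
    exact hB y ⟨x, z, z', h.symm, h2, h4, h1.symm, h3.symm, hne⟩
  suffices ∃ z, z ≠ x ∧ G.Adj y z by
    obtain ⟨z, hz⟩ := this
    exact ⟨z, hz, fun z' hz' => huniq _ _ hz' hz⟩
  by_contra! hno
  let B : V → Prop := fun w => ∀ a b, G.Adj w a → G.Adj w b → a = b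
  have hBy : B y := fun a b ha hb => by
    rw [of_not_not fun hne => hno a hne ha, of_not_not fun hne => hno b hne hb]
  obtain ⟨R, hR⟩ := hq.exists_dist_le (B := B) (fun f w hw a b ha hb => by
    have := hw (f.symm a) (f.symm b) (by simpa using f.symm.map_adj_iff.2 ha)
      (by simpa using f.symm.map_adj_iff.2 hb)
    exact f.symm.injective this) hBy
  obtain ⟨r, hr0, hadj, hd⟩ := exists_geodesic_ray hc hf y
  -- The centre `R + 1` keeps the ball of radius `R` away from `r 0`, so the vertex found has two
  -- distinct ray neighbours.
  obtain ⟨w, hw, hwR⟩ := hR (r (R + 1))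
  have hinj := injective_of_dist hd
  have hns : ∀ n, R + 1 ≤ n + R → n ≤ R + 1 + R → ∀ u, G.Adj (r n) u → ∃ i, u = r i ∧
      i ≤ n + 1 ∧ n ≤ i + 1 := by
    intro n hn _ u hu
    obtain ⟨n, rfl⟩ : ∃ m, n = m + 1 := ⟨n - 1, by omega⟩
    by_contra! hno'
    refine hB (r (n + 1)) ⟨r n, r (n + 2), u, (hadj n).symm, hadj (n + 1), hu,
      hinj.ne (by omega), fun h => ?_, fun h => ?_⟩
    · have := hno' n h.symm; omega
    · have := hno' (n + 2) h.symm; omega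
  obtain ⟨n, rfl, h1, h2⟩ := exists_eq_of_dist_le hc hns _ hwR rfl
  obtain ⟨n, rfl⟩ : ∃ m, n = m + 1 := ⟨n - 1, by omega⟩
  have := hinj (hw _ _ (hadj n).symm (hadj (n + 1)))
  omega

/-- An infinite connected graph which is regular of degree two is a two-sided infinite path. -/
theorem nonempty_iso_intPath {V : Type*} [Infinite V] {G : SimpleGraph V}
    (hc : G.Connected) (h2 : ∀ x y, G.Adj x y → ∃! z, z ≠ x ∧ G.Adj y z)
    {x₀ y₀ : V} (h₀ : G.Adj x₀ y₀) : Nonempty (G ≃g intPath) := by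
  choose! o ho hu using h2
  -- Walking straight on is a permutation of the oriented edges; its integer powers trace the
  -- bi-infinite walk `p`.
  let σ : Equiv.Perm {d : V × V // G.Adj d.1 d.2} :=
    { toFun := fun d => ⟨(d.1.2, o d.1.1 d.1.2), (ho _ _ d.2).2⟩
      invFun := fun d => ⟨(o d.1.2 d.1.1, d.1.1), (ho _ _ d.2.symm).2.symm⟩
      left_inv := fun ⟨⟨x, y⟩, h⟩ => by
        have h1 := ho x y h
        have h2 := hu _ _ h1.2.symm x ⟨h1.1.symm, h.symm⟩
        simp only [Subtype.mk.injEq, Prod.mk.injEq, and_true]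
        exact h2.symm
      right_inv := fun ⟨⟨x, y⟩, h⟩ => by
        have h1 := ho y x h.symm
        have h2 := hu _ _ h1.2.symm y ⟨h1.1.symm, h⟩
        simp only [Subtype.mk.injEq, Prod.mk.injEq, true_and]
        exact h2.symm }
  let d : ℤ → {d : V × V // G.Adj d.1 d.2} := fun n => (σ ^ n) ⟨(x₀, y₀), h₀⟩
  have hd : ∀ n, d (n + 1) = σ (d n) := fun n => by
    simp only [d, add_comm n 1, zpow_add, zpow_one, Equiv.Perm.mul_apply]
  let p : ℤ → V := fun n => (d n).1.1
  have hp1 : ∀ n, p (n + 1) = (d n).1.2 := fun n => by simp only [p, hd]; rfl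
  have hadj : ∀ n, G.Adj (p n) (p (n + 1)) := fun n => by rw [hp1]; exact (d n).2
  have hp2 : ∀ n, p (n + 2) = o (p n) (p (n + 1)) := fun n => by
    rw [show n + 2 = n + 1 + 1 by ring, hp1 (n + 1), hd, hp1]; rfl
  have hnb : ∀ n z, G.Adj (p (n + 1)) z → z = p n ∨ z = p (n + 2) := fun n z hz => by
    by_cases h : z = p n
    · exact Or.inl h
    · exact Or.inr (hp2 n ▸ hu _ _ (hadj n) z ⟨h, hz⟩)
  have hne2 : ∀ n, p (n + 2) ≠ p n := fun n => hp2 n ▸ (ho _ _ (hadj n)).1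
  have hsurj : Function.Surjective p := by
    intro w
    obtain ⟨q⟩ := hc.preconnected w (p 0)
    generalize hz : p 0 = z at q
    induction q with
    | nil => exact ⟨0, hz⟩
    | cons h q ih =>
      obtain ⟨n, hn⟩ := ih hz
      subst hn
      obtain ⟨m, rfl⟩ : ∃ m, n = m + 1 := ⟨n - 1, by ring⟩
      rcases hnb m _ h.symm with h | h
      · exact ⟨_, h.symm⟩
      · exact ⟨_, h.symm⟩
  have hinj : Function.Injective p := by
    refine .of_lt_imp_ne fun a b hab he => ?_
    -- A repeated vertex is passed either in the same direction, making `p` periodic and its range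
    -- finite, or in the opposite direction, making `p` a reflection between `a` and `b`.
    by_cases h1 : p (b + 1) = p (a + 1)
    · have hdd : d a = d b := Subtype.ext (Prod.ext he (by rw [← hp1, ← hp1, h1]))
      have hper : ∀ n, p (n + (b - a)) = p n := fun n => by
        have : d (n + (b - a)) = d n := by
          simp only [d] at hdd ⊢
          have : n + (b - a) = (n - a) + b := by ring
          rw [this, zpow_add, Equiv.Perm.mul_apply, ← hdd, ← Equiv.Perm.mul_apply, ← zpow_add,
            sub_add_cancel]
        simp only [p, this]
      have hpm : ∀ n, p n = p (n % (b - a)) := fun n => by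
        have h := Function.Periodic.sub_zsmul_eq (f := p) (x := n) hper (n / (b - a))
        rwa [smul_eq_mul, mul_comm, ← Int.emod_def, eq_comm] at h
      have : Set.Finite (Set.range p) := by
        refine ((Set.finite_Ico (0 : ℤ) (b - a)).image p).subset ?_
        rintro _ ⟨n, rfl⟩
        exact ⟨n % (b - a), ⟨Int.emod_nonneg _ (by omega), Int.emod_lt_of_pos _ (by omega)⟩,
          (hpm n).symm⟩
      rw [hsurj.range_eq] at this
      exact Set.infinite_univ this
    · have hrefl : ∀ k : ℕ, p (a + k) = p (b - k) ∧ p (a + k + 1) = p (b - k - 1) := by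
        intro k
        induction k with
        | zero =>
          refine ⟨by simpa using he, ?_⟩
          have h3 : G.Adj (p (b - 1 + 1)) (p (a + 1)) := by
            rw [sub_add_cancel, ← he]; exact hadj a
          rcases hnb _ _ h3 with h | h
          · simpa using h
          · exact absurd (by rw [h]; congr 1; ring) h1
        | succ k ih =>
          have e1 : a + ((k + 1 : ℕ) : ℤ) = a + k + 1 := by push_cast; ring
          have e2 : b - ((k + 1 : ℕ) : ℤ) = b - k - 1 := by push_cast; ring
          rw [e1, e2]
          refine ⟨ih.2, ?_⟩
          have h3 : G.Adj (p (b - k - 2 + 1)) (p (a + k + 1 + 1)) := by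
            rw [show b - (k : ℤ) - 2 + 1 = b - k - 1 by ring, ← ih.2]; exact hadj _
          rcases hnb _ _ h3 with h | h
          · rw [h]; congr 1; ring
          · exfalso
            refine hne2 (a + k) ?_
            rw [show a + (k : ℤ) + 2 = a + k + 1 + 1 by ring, h, ih.1]; congr 1; ring
      -- At the centre of the reflection there is a loop if `b - a` is odd and a backtracking step
      -- if it is even.
      obtain ⟨k, hk | hk⟩ : ∃ k : ℕ, b = a + 2 * k + 1 ∨ b = a + 2 * k + 2 :=
        ⟨((b - a - 1) / 2).toNat, by omega⟩
      · refine (hadj (a + k)).ne ?_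
        rw [(hrefl k).1]; congr 1; omega
      · refine hne2 (a + k) ?_
        rw [(hrefl k).1]; congr 1; omega
  refine ⟨(SimpleGraph.Iso.symm ⟨Equiv.ofBijective p ⟨hinj, hsurj⟩, ?_⟩)⟩
  intro a b
  simp only [intPath]
  constructor
  · intro h
    obtain ⟨c, rfl⟩ : ∃ c, a = c + 1 := ⟨a - 1, by ring⟩
    rcases hnb c _ h with h | h
    · exact Or.inr (by rw [hinj h])
    · exact Or.inl (by rw [hinj h]; ring)
  · rintro (rfl | rfl)
    · exact hadj a
    · exact (hadj b).symm

/-! ### Vanishing products, laws of large numbers, and level one on branching graphs. -/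

open MeasureTheory ProbabilityTheory Filter Topology

/-- A product of factors `1 - 1 / (W (j + 1))` over a set of positive lower density vanishes. -/
theorem exists_prod_lt_of_density {J : Set ℕ} [DecidablePred (· ∈ J)] {c : ℝ} (hc : 0 < c)
    (hJ : ∀ᶠ n : ℕ in atTop, c * n ≤ ((Finset.range n).filter (· ∈ J)).card)
    {W : ℝ} (hW : 1 ≤ W) {ε : ℝ} (hε : 0 < ε) :
    ∃ n, ∏ j ∈ Finset.range n with j ∈ J, (1 - 1 / (W * (j + 1))) < ε := by
  set f : ℕ → ℝ := fun j => if j ∈ J then 1 / ((j : ℝ) + 1) else 0 with hfdef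
  have hf0 : ∀ j, 0 ≤ f j := fun j => by simp only [hfdef]; split_ifs <;> positivity
  have hns : ¬ Summable f := by
    intro hs
    have h1 := hs.hasSum.tendsto_sum_nat
    obtain ⟨N, hN⟩ := (Metric.tendsto_atTop.1 h1) (c / 4) (by positivity)
    obtain ⟨m, hm1, hm2, hm3⟩ := (hJ.and ((eventually_ge_atTop (N + 1)).and
      (tendsto_natCast_atTop_atTop.eventually_ge_atTop (4 * N / c)))).exists
    have hmpos : (0 : ℝ) < m := by exact_mod_cast (by omega : 0 < m)
    have h2 := hN N le_rfl
    have h3 := hN m (by omega)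
    rw [Real.dist_eq, abs_lt] at h2 h3
    -- Each element of `J` in `[N, m)` contributes at least `1 / m`. For large `m` this block is at
    -- least `3 * c / 4`, against the Cauchy bound `c / 2`.
    have h4 : ((((Finset.range m).filter (· ∈ J)).card : ℝ) - N) / m ≤
        ∑ j ∈ Finset.range m, f j - ∑ j ∈ Finset.range N, f j := by
      rw [← Finset.sum_Ico_eq_sub _ (by omega : N ≤ m), div_le_iff₀ hmpos, Finset.sum_mul]
      have h5 : ((Finset.range m).filter (· ∈ J)).card ≤
          N + ((Finset.Ico N m).filter (· ∈ J)).card := by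
        rw [Finset.range_eq_Ico, ← Finset.Ico_union_Ico_eq_Ico (Nat.zero_le N) (by omega : N ≤ m),
          Finset.filter_union]
        refine (Finset.card_union_le _ _).trans (Nat.add_le_add_right ?_ _)
        simpa using Finset.card_filter_le (Finset.Ico 0 N) (· ∈ J)
      have h6 : (((Finset.Ico N m).filter (· ∈ J)).card : ℝ) ≤ ∑ j ∈ Finset.Ico N m, f j * m := by
        rw [Finset.card_filter, Nat.cast_sum]
        refine Finset.sum_le_sum fun j hj => ?_
        have hj' : (j : ℝ) + 1 ≤ m := by exact_mod_cast (Finset.mem_Ico.1 hj).2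
        simp only [hfdef]
        split_ifs
        · rw [one_div, inv_mul_eq_div, Nat.cast_one, le_div_iff₀ (by positivity)]; linarith
        · simp
      have h7 : (((Finset.range m).filter (· ∈ J)).card : ℝ) ≤
          N + ((Finset.Ico N m).filter (· ∈ J)).card := by exact_mod_cast h5
      linarith
    rw [div_le_iff₀ hmpos] at h4
    rw [div_le_iff₀ hc] at hm3
    have h5 : (∑ j ∈ Finset.range m, f j - ∑ j ∈ Finset.range N, f j) * m < c / 2 * m :=
      mul_lt_mul_of_pos_right (by linarith [h2.1, h3.2]) hmpos
    nlinarith [mul_pos hc hmpos]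
  have htop := (not_summable_iff_tendsto_nat_atTop_of_nonneg hf0).1 hns
  have hexp : Tendsto (fun n => Real.exp (-((∑ j ∈ Finset.range n, f j) / W))) atTop (𝓝 0) :=
    Real.tendsto_exp_neg_atTop_nhds_zero.comp (htop.atTop_div_const (by linarith))
  obtain ⟨n, hn⟩ := (hexp.eventually (gt_mem_nhds hε)).exists
  refine ⟨n, lt_of_le_of_lt ?_ hn⟩
  rw [Finset.sum_div, ← Finset.sum_neg_distrib, Real.exp_sum, Finset.prod_filter]
  refine Finset.prod_le_prod (fun j _ => ?_) fun j _ => ?_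
  · split_ifs
    · have : 1 / (W * ((j : ℝ) + 1)) ≤ 1 := by
        rw [div_le_one (by positivity)]
        have : (0 : ℝ) ≤ j := by positivity
        nlinarith
      linarith
    · exact zero_le_one
  · simp only [hfdef]
    split_ifs
    · have := Real.add_one_le_exp (-(1 / ((j : ℝ) + 1) / W))
      rw [div_div, mul_comm] at this
      rw [div_div, mul_comm W]
      rw [mul_comm W] at this
      linarith
    · simp

section Uniform

variable {Ω : Type*} [MeasurableSpace Ω] {P : Measure Ω}

theorem ae_mem_of_isUniform {X : Ω → ℝ} (h : pdf.IsUniform X (Set.Ioo (0 : ℝ) 1) P volume) :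
    ∀ᵐ ω ∂P, X ω ∈ Set.Ioo (0 : ℝ) 1 := by
  have h1 := h.measure_preimage (by simp) (by simp)
    (measurableSet_Ioo (a := (0 : ℝ)) (b := 1)).compl
  rw [Set.inter_compl_self, measure_empty, ENNReal.zero_div] at h1
  exact h1

theorem measure_ge_of_isUniform {X : Ω → ℝ} (h : pdf.IsUniform X (Set.Ioo (0 : ℝ) 1) P volume)
    {a : ℝ} (h0 : 0 < a) : P (X ⁻¹' Set.Ici a) = ENNReal.ofReal (1 - a) := by
  have h1 := h.measure_preimage (by simp) (by simp) (measurableSet_Ici (a := a))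
  have h2 : Set.Ioo (0 : ℝ) 1 ∩ Set.Ici a = Set.Ico a 1 := by
    ext x; simp only [Set.mem_inter_iff, Set.mem_Ioo, Set.mem_Ici, Set.mem_Ico]
    constructor
    · rintro ⟨⟨_, h⟩, h'⟩; exact ⟨h', h⟩
    · rintro ⟨h, h'⟩; exact ⟨⟨by linarith, h'⟩, h⟩
  rw [h1, h2]
  simp

theorem integral_of_isUniform {X : Ω → ℝ} (h : pdf.IsUniform X (Set.Ioo (0 : ℝ) 1) P volume) :
    ∫ ω, X ω ∂P = 1 / 2 := by
  rw [h.integral_eq, ← integral_Ioc_eq_integral_Ioo,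
    ← intervalIntegral.integral_of_le zero_le_one]
  simp

theorem identDistrib_of_isUniform {X Y : Ω → ℝ} (hX : Measurable X) (hY : Measurable Y)
    (h : pdf.IsUniform X (Set.Ioo (0 : ℝ) 1) P volume)
    (h' : pdf.IsUniform Y (Set.Ioo (0 : ℝ) 1) P volume) : IdentDistrib X Y P P :=
  ⟨hX.aemeasurable, hY.aemeasurable, Eq.trans h (Eq.symm h')⟩

/-- The law of large numbers for a bounded function of i.i.d. uniform random variables. -/
theorem ae_tendsto_average [IsProbabilityMeasure P] {V : Type*} {η : V → Ω → ℝ}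
    (hm : ∀ u, Measurable (η u))
    (hu : ∀ u, pdf.IsUniform (η u) (Set.Ioo (0 : ℝ) 1) P volume) (hi : iIndepFun η P)
    {u : ℕ → V} (huinj : Function.Injective u) {g : ℝ → ℝ} (hg : Measurable g)
    (hint : Integrable (fun ω => g (η (u 0) ω)) P) :
    ∀ᵐ ω ∂P, Tendsto (fun n : ℕ => (∑ j ∈ Finset.range n, g (η (u j) ω)) / n) atTop
      (𝓝 (∫ ω, g (η (u 0) ω) ∂P)) := by
  refine strong_law_ae_real (fun j ω => g (η (u j) ω)) hint ?_ fun i => ?_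
  · intro i j hij
    exact (hi.indepFun (huinj.ne hij)).comp hg hg
  · exact (identDistrib_of_isUniform (hm _) (hm _) (hu _) (hu _)).comp hg

theorem ae_density [IsProbabilityMeasure P] {V : Type*} {η : V → Ω → ℝ}
    (hm : ∀ u, Measurable (η u))
    (hu : ∀ u, pdf.IsUniform (η u) (Set.Ioo (0 : ℝ) 1) P volume) (hi : iIndepFun η P)
    {u : ℕ → V} (huinj : Function.Injective u) {a : ℝ} (h0 : 0 < a) (h1 : a < 1) :
    ∀ᵐ ω ∂P, ∀ᶠ n : ℕ in atTop, (1 - a) / 2 * n ≤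
      ((Finset.range n).filter (fun j => a ≤ η (u j) ω)).card := by
  have hmeas : Measurable ((Set.Ici a).indicator (1 : ℝ → ℝ)) :=
    measurable_one.indicator measurableSet_Ici
  have hind : (fun ω => (Set.Ici a).indicator (1 : ℝ → ℝ) (η (u 0) ω)) =
      (η (u 0) ⁻¹' Set.Ici a).indicator 1 := rfl
  have hms : MeasurableSet (η (u 0) ⁻¹' Set.Ici a) := hm _ measurableSet_Ici
  have hval : ∫ ω, (Set.Ici a).indicator (1 : ℝ → ℝ) (η (u 0) ω) ∂P = 1 - a := by
    rw [hind, integral_indicator_one hms, measureReal_def, measure_ge_of_isUniform (hu _) h0,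
      ENNReal.toReal_ofReal (by linarith)]
  have hint : Integrable (fun ω => (Set.Ici a).indicator (1 : ℝ → ℝ) (η (u 0) ω)) P := by
    rw [hind]; exact (integrable_const (1 : ℝ)).indicator hms
  have := ae_tendsto_average hm hu hi huinj hmeas hint
  rw [hval] at this
  filter_upwards [this] with ω hω
  filter_upwards [hω.eventually (lt_mem_nhds (show (1 - a) / 2 < 1 - a by linarith)),
    eventually_gt_atTop 0] with n hn hn0
  rw [lt_div_iff₀ (by exact_mod_cast hn0)] at hn
  refine hn.le.trans (le_of_eq ?_)
  rw [Finset.card_filter, Nat.cast_sum]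
  refine Finset.sum_congr rfl fun j _ => ?_
  simp [Set.indicator_apply]

/-- On a graph with a ray whose side neighbours have positive density, arbitrarily high water
levels can be achieved. -/
theorem ae_kappa_eq_one [IsProbabilityMeasure P] {V : Type*} [Countable V] {G : SimpleGraph V}
    {η : V → Ω → ℝ} (hm : ∀ u, Measurable (η u))
    (hu : ∀ u, pdf.IsUniform (η u) (Set.Ioo (0 : ℝ) 1) P volume) (hi : iIndepFun η P)
    {r : ℕ → V} (hinj : Function.Injective r) (hadj : ∀ n, G.Adj (r n) (r (n + 1))) {M : ℕ}
    {f : ℕ → ℕ} {u : ℕ → V} (hf : ∀ j, f j < M * (j + 1)) (hur : ∀ j, u j ∉ Set.range r)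
    (huinj : Function.Injective u) (hfu : ∀ j, G.Adj (r (f j)) (u j)) :
    ∀ᵐ ω ∂P, kappa G (fun u => η u ω) (r 0) = 1 := by
  classical
  have hM : 1 ≤ M := Nat.pos_of_ne_zero fun h => by have := hf 0; simp [h] at this
  have hM' : (1 : ℝ) ≤ M := by exact_mod_cast hM
  have hbox := ae_all_iff.2 fun u => ae_mem_of_isUniform (hu u)
  -- Countably many thresholds tending to `1` suffice; the shift by `2` keeps them positive at `k =
  -- 0`.
  have hdens := ae_all_iff.2 fun k : ℕ => ae_density hm hu hi huinj
    (a := 1 - 1 / ((k : ℝ) + 2)) (by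
      rw [sub_pos, div_lt_one (by positivity)]; linarith [(Nat.cast_nonneg k : (0 : ℝ) ≤ k)])
    (by linarith [show (0 : ℝ) < 1 / ((k : ℝ) + 2) by positivity])
  filter_upwards [hbox, hdens] with ω hω hd
  have hI : ∀ w, η w ω ∈ Set.Icc (0 : ℝ) 1 := fun w => Set.Ioo_subset_Icc_self (hω w)
  refine le_antisymm (kappa_le (η := fun u => η u ω) (hI (r 0)).1 fun ms =>
    (finalProfile_mem_Icc (η := fun u => η u ω) ms hI _).2) ?_
  refine le_of_forall_pos_lt_add fun ε hε => ?_
  obtain ⟨k, hk⟩ := exists_nat_one_div_lt (half_pos hε)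
  have hk2 : 1 / ((k : ℝ) + 2) ≤ 1 / ((k : ℝ) + 1) := by gcongr; linarith
  have hkpos : 0 < 1 / ((k : ℝ) + 2) := by positivity
  set a := 1 - 1 / ((k : ℝ) + 2) with ha
  obtain ⟨n, hn⟩ := exists_prod_lt_of_density (J := {j | a ≤ η (u j) ω})
    (by linarith : 0 < (1 - a) / 2) (hd k) (by linarith : (1 : ℝ) ≤ 2 * M) (half_pos hε)
  obtain ⟨ζ, hζ, hle⟩ := exists_attainable_ray hinj hadj hf hur huinj hfu a
    {j | a ≤ η (u j) ω} n hI (D := 1) (fun i _ => by have := (hI (r i)).1; linarith)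
    fun j _ hj => hj
  have h1 := hζ.le_kappa hI (r 0)
  simp only [← mul_assoc] at hle
  rw [one_mul] at hle
  linarith

end Uniform

/-! ### Dual weights on the two-sided path: unimodality and decay. -/

theorem sum_int_Ico_consecutive (f : ℤ → ℝ) {a b c : ℤ} (hab : a ≤ b) (hbc : b ≤ c) :
    ∑ w ∈ Finset.Ico a b, f w + ∑ w ∈ Finset.Ico b c, f w = ∑ w ∈ Finset.Ico a c, f w := by
  rw [← Finset.sum_union (Finset.Ico_disjoint_Ico_consecutive a b c),
    Finset.Ico_union_Ico_eq_Ico hab hbc]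

theorem sum_int_Ico_add_one (f : ℤ → ℝ) (a : ℤ) : ∑ w ∈ Finset.Ico a (a + 1), f w = f a := by
  have : Finset.Ico a (a + 1) = {a} := by
    ext; simp only [Finset.mem_Ico, Finset.mem_singleton]; omega
  rw [this, Finset.sum_singleton]

/-- The effect of a move along the edge `⟨k, k + 1⟩` of the two-sided infinite path. -/
noncomputable def edgeMove (k : ℤ) (μ : ℝ) (ξ : ℤ → ℝ) : ℤ → ℝ := fun w =>
  ξ w + μ * (ξ (k + 1) - ξ k) * ((if w = k then 1 else 0) - (if w = k + 1 then 1 else 0))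

theorem edgeMove_left (k : ℤ) (μ : ℝ) (ξ : ℤ → ℝ) :
    edgeMove k μ ξ k = ξ k + μ * (ξ (k + 1) - ξ k) := by simp [edgeMove]

theorem edgeMove_right (k : ℤ) (μ : ℝ) (ξ : ℤ → ℝ) :
    edgeMove k μ ξ (k + 1) = ξ (k + 1) - μ * (ξ (k + 1) - ξ k) := by simp [edgeMove]; ring

theorem edgeMove_of_ne {k w : ℤ} (μ : ℝ) (ξ : ℤ → ℝ) (h1 : w ≠ k) (h2 : w ≠ k + 1) :
    edgeMove k μ ξ w = ξ w := by simp [edgeMove, h1, h2]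

theorem Move.exists_edgeMove (m : Move intPath) :
    ∃ k, ∀ ξ : ℤ → ℝ, m.apply ξ = edgeMove k m.μ ξ := by
  rcases (m.adj : m.y = m.x + 1 ∨ m.x = m.y + 1) with h | h
  · refine ⟨m.x, fun ξ => funext fun w => ?_⟩
    rw [Move.apply_apply, edgeMove, h]
    congr!
  · refine ⟨m.y, fun ξ => funext fun w => ?_⟩
    rw [Move.apply_apply, edgeMove, ← h]
    split_ifs <;> ring

theorem edgeMove_nonneg {k : ℤ} {μ : ℝ} (h0 : 0 < μ) (h1 : μ ≤ 1 / 2) {ξ : ℤ → ℝ}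
    (h : ∀ w, 0 ≤ ξ w) (w : ℤ) : 0 ≤ edgeMove k μ ξ w := by
  have ha := h k
  have hb := h (k + 1)
  by_cases hk : w = k
  · rw [hk, edgeMove_left]; nlinarith
  by_cases hk' : w = k + 1
  · rw [hk', edgeMove_right]; nlinarith
  rw [edgeMove_of_ne _ _ hk hk']; exact h w

/-- Reflection about the origin, used to obtain decay to the left from decay to the right. -/
theorem edgeMove_comp_neg (k : ℤ) (μ : ℝ) (ξ : ℤ → ℝ) :
    (fun w => edgeMove k μ ξ (-w)) = edgeMove (-k - 1) μ (fun w => ξ (-w)) := by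
  funext w
  simp only [edgeMove]
  rw [show -(-k - 1 + 1) = k by ring, show -(-k - 1) = k + 1 by ring]
  have h1 : (-w = k) ↔ w = -k - 1 + 1 := by omega
  have h2 : (-w = k + 1) ↔ w = -k - 1 := by omega
  simp only [h1, h2]
  split_ifs <;> ring

def IsMode (ξ : ℤ → ℝ) (m : ℤ) : Prop :=
  (∀ w < m, ξ w ≤ ξ (w + 1)) ∧ ∀ w ≥ m, ξ (w + 1) ≤ ξ w

theorem IsMode.le {ξ : ℤ → ℝ} {m : ℤ} (h : IsMode ξ m) (w : ℤ) : ξ w ≤ ξ m := by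
  have h1 : ∀ k : ℕ, ξ (m + k) ≤ ξ m := by
    intro k
    induction k with
    | zero => simp
    | succ k ih =>
      have := h.2 (m + k) (by omega)
      push_cast
      rw [← add_assoc]
      linarith
  have h2 : ∀ k : ℕ, ξ (m - k) ≤ ξ m := by
    intro k
    induction k with
    | zero => simp
    | succ k ih =>
      have := h.1 (m - (k + 1 : ℕ)) (by omega)
      rw [show m - ((k + 1 : ℕ) : ℤ) + 1 = m - k by push_cast; ring] at this
      linarith
  rcases le_total m w with hw | hw
  · obtain ⟨k, rfl⟩ := Int.le.dest hw
    exact h1 k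
  · obtain ⟨k, hk⟩ := Int.le.dest hw
    rw [show w = m - k by omega]
    exact h2 k

/-- Moves preserve unimodality. -/
theorem IsMode.exists_edgeMove {ξ : ℤ → ℝ} {m : ℤ} (h : IsMode ξ m) (k : ℤ) {μ : ℝ} (h0 : 0 < μ)
    (h1 : μ ≤ 1 / 2) : ∃ m', IsMode (edgeMove k μ ξ) m' := by
  set ζ := edgeMove k μ ξ with hζ
  have e1 : ζ k = ξ k + μ * (ξ (k + 1) - ξ k) := edgeMove_left k μ ξ
  have e2 : ζ (k + 1) = ξ (k + 1) - μ * (ξ (k + 1) - ξ k) := edgeMove_right k μ ξ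
  have e3 : ∀ w, w ≠ k → w ≠ k + 1 → ζ w = ξ w := fun w => edgeMove_of_ne μ ξ
  -- Only the three steps from `k - 1` to `k + 2` can change. The mode shifts by at most one, and
  -- only when the move drains the peak below its outer neighbour.
  have key : ∀ m', (∀ w < m', w ≠ k - 1 → w ≠ k → w ≠ k + 1 → w < m) →
      (∀ w ≥ m', w ≠ k - 1 → w ≠ k → w ≠ k + 1 → w ≥ m) →
      (k - 1 < m' → ζ (k - 1) ≤ ζ k) → (k < m' → ζ k ≤ ζ (k + 1)) →
      (k + 1 < m' → ζ (k + 1) ≤ ζ (k + 2)) → (k - 1 ≥ m' → ζ k ≤ ζ (k - 1)) →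
      (k ≥ m' → ζ (k + 1) ≤ ζ k) → (k + 1 ≥ m' → ζ (k + 2) ≤ ζ (k + 1)) → IsMode ζ m' := by
    intro m' hl hr a1 a2 a3 b1 b2 b3
    refine ⟨fun w hw => ?_, fun w hw => ?_⟩
    · by_cases w1 : w = k - 1
      · subst w1; rw [sub_add_cancel]; exact a1 hw
      by_cases w2 : w = k
      · subst w2; exact a2 hw
      by_cases w3 : w = k + 1
      · subst w3; rw [add_assoc]; exact a3 hw
      rw [e3 w w2 w3, e3 (w + 1) (by omega) (by omega)]
      exact h.1 w (hl w hw w1 w2 w3)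
    · by_cases w1 : w = k - 1
      · subst w1; rw [sub_add_cancel]; exact b1 hw
      by_cases w2 : w = k
      · subst w2; exact b2 hw
      by_cases w3 : w = k + 1
      · subst w3; rw [add_assoc]; exact b3 hw
      rw [e3 w w2 w3, e3 (w + 1) (by omega) (by omega)]
      exact h.2 w (hr w hw w1 w2 w3)
  have f1 : ζ (k - 1) = ξ (k - 1) := e3 _ (by omega) (by omega)
  have f2 : ζ (k + 2) = ξ (k + 2) := e3 _ (by omega) (by omega)
  have g1 : k - 1 < m → ξ (k - 1) ≤ ξ k := fun hk => by simpa using h.1 (k - 1) hk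
  have g2 : k - 1 ≥ m → ξ k ≤ ξ (k - 1) := fun hk => by simpa using h.2 (k - 1) hk
  have g3 : k + 1 < m → ξ (k + 1) ≤ ξ (k + 2) := fun hk => by
    simpa [add_assoc] using h.1 (k + 1) hk
  have g4 : k + 1 ≥ m → ξ (k + 2) ≤ ξ (k + 1) := fun hk => by
    simpa [add_assoc] using h.2 (k + 1) hk
  rcases lt_or_ge k m with hk | hk
  · have hab := h.1 k hk
    have i1 : ζ (k - 1) ≤ ζ k := by rw [f1, e1]; nlinarith [g1 (by omega)]
    have i2 : ζ k ≤ ζ (k + 1) := by rw [e1, e2]; nlinarith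
    by_cases hb : ζ (k + 1) ≤ ζ (k + 2)
    · by_cases hkm : k + 1 < m
      · exact ⟨m, key m (by omega) (by omega) (fun _ => i1) (fun _ => i2) (fun _ => hb)
          (by omega) (by omega) (by omega)⟩
      · exact ⟨m + 1, key (m + 1) (by omega) (by omega) (fun _ => i1) (fun _ => i2) (fun _ => hb)
          (by omega) (by omega) (by omega)⟩
    · have hkm : ¬ k + 1 < m := fun hkm => hb (by rw [f2, e2]; nlinarith [g3 hkm])
      exact ⟨m, key m (by omega) (by omega) (fun _ => i1) (fun _ => i2) (by omega)
          (by omega) (by omega) (fun _ => (not_le.1 hb).le)⟩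
  · have hab := h.2 k hk
    have i1 : ζ (k + 2) ≤ ζ (k + 1) := by rw [f2, e2]; nlinarith [g4 (by omega)]
    have i2 : ζ (k + 1) ≤ ζ k := by rw [e1, e2]; nlinarith
    by_cases hb : ζ k ≤ ζ (k - 1)
    · by_cases hkm : k - 1 ≥ m
      · exact ⟨m, key m (by omega) (by omega) (by omega) (by omega) (by omega)
          (fun _ => hb) (fun _ => i2) (fun _ => i1)⟩
      · exact ⟨m - 1, key (m - 1) (by omega) (by omega) (by omega) (by omega) (by omega)
          (fun _ => hb) (fun _ => i2) (fun _ => i1)⟩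
    · have hkm : ¬ k - 1 ≥ m := fun hkm => hb (by rw [f1, e1]; nlinarith [g2 hkm])
      exact ⟨m, key m (by omega) (by omega) (fun _ => (not_le.1 hb).le) (by omega) (by omega)
          (by omega) (fun _ => i2) (fun _ => i1)⟩

/-- An upper bound on the mass in intervals to the right of the origin. -/
def HasRightDecay (ξ : ℤ → ℝ) : Prop :=
  ∀ i j : ℤ, 0 ≤ i → i ≤ j → 0 < j → ∑ w ∈ Finset.Ico i j, ξ w ≤ 1 - (i : ℝ) / j

theorem sum_edgeMove (k : ℤ) (μ : ℝ) (ξ : ℤ → ℝ) (s : Finset ℤ) :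
    ∑ w ∈ s, edgeMove k μ ξ w = ∑ w ∈ s, ξ w + μ * (ξ (k + 1) - ξ k) *
      ((if k ∈ s then 1 else 0) - (if k + 1 ∈ s then 1 else 0)) := by
  simp only [edgeMove, Finset.sum_add_distrib, ← Finset.mul_sum, Finset.sum_sub_distrib,
    Finset.sum_ite_eq']

/-- A move matters only across an end of the interval. The new sum is then a convex combination,
with weights `μ`, `1 - 2 * μ`, `μ`, of the old sums with that end shifted by `-1`, `0`, `1`. The
bound `1 - i / j` survives because it is affine in `i` and concave in `j`. For `i = 0` it is just
the bound on the total mass. -/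
theorem HasRightDecay.edgeMove {ξ : ℤ → ℝ} (h : HasRightDecay ξ) (k : ℤ) {μ : ℝ} (h0 : 0 < μ)
    (h1 : μ ≤ 1 / 2) (hmass : ∀ s : Finset ℤ, ∑ w ∈ s, edgeMove k μ ξ w ≤ 1) :
    HasRightDecay (edgeMove k μ ξ) := by
  intro i j hi hij hj
  rcases hi.eq_or_lt with rfl | hi
  · simpa using hmass _
  rcases hij.eq_or_lt with rfl | hij
  · have : (i : ℝ) ≠ 0 := by exact_mod_cast hj.ne'
    simp [this]
  have hS := h i j hi.le hij.le hj
  have hjR : (0 : ℝ) < j := by exact_mod_cast hj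
  rw [sum_edgeMove]
  simp only [Finset.mem_Ico]
  by_cases c1 : k + 1 = i
  · subst c1
    have hA := h k j (by omega) (by omega) hj
    have hB := h (k + 1 + 1) j (by omega) (by omega) hj
    have eA := sum_int_Ico_consecutive ξ (show k ≤ k + 1 by omega) hij.le
    have eB := sum_int_Ico_consecutive ξ (show k + 1 ≤ k + 1 + 1 by omega)
      (show k + 1 + 1 ≤ j by omega)
    rw [sum_int_Ico_add_one] at eA eB
    rw [if_neg (by omega), if_pos (by omega)]
    push_cast at hA hB hS ⊢
    have : ((k : ℝ) + 1 + 1) / j = 2 * ((k + 1) / j) - k / j := by ring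
    nlinarith
  by_cases c2 : k + 1 = j
  · subst c2
    have hA := h i (k + 1 + 1) hi.le (by omega) (by omega)
    have hB := h i k hi.le (by omega) (by omega)
    have eA := sum_int_Ico_consecutive ξ hij.le (show k + 1 ≤ k + 1 + 1 by omega)
    have eB := sum_int_Ico_consecutive ξ (show i ≤ k by omega) (show k ≤ k + 1 by omega)
    rw [sum_int_Ico_add_one] at eA eB
    rw [if_pos (by omega), if_neg (by omega)]
    have hk : (0 : ℝ) < k := by exact_mod_cast (by omega : 0 < k)
    have hiR : (0 : ℝ) < i := by exact_mod_cast hi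
    have hconv : 2 * ((i : ℝ) / (k + 1)) ≤ i / k + i / (k + 1 + 1) := by
      have : (i : ℝ) / k + i / (k + 1 + 1) - 2 * (i / (k + 1)) =
          2 * i / (k * (k + 1) * (k + 1 + 1)) := by field_simp; ring
      have : 0 ≤ 2 * (i : ℝ) / (k * (k + 1) * (k + 1 + 1)) := by positivity
      linarith
    push_cast at hA hB hS ⊢
    nlinarith
  have : (if i ≤ k ∧ k < j then (1 : ℝ) else 0) = if i ≤ k + 1 ∧ k + 1 < j then 1 else 0 := by
    have : (i ≤ k ∧ k < j) ↔ (i ≤ k + 1 ∧ k + 1 < j) := by omega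
    simp only [this]
  rw [this]
  linarith

/-- The level at the origin after finitely many moves is a weighted average of the initial levels,
the weights being unimodal and decaying with the distance from the origin. -/
theorem exists_weights (ms : List (Move intPath)) :
    ∃ (ξ : ℤ → ℝ) (s : Finset ℤ) (m : ℤ), (∀ w, 0 ≤ ξ w) ∧ (∀ w ∉ s, ξ w = 0) ∧
      ∑ w ∈ s, ξ w = 1 ∧ IsMode ξ m ∧ HasRightDecay ξ ∧ HasRightDecay (fun w => ξ (-w)) ∧
      ∀ η : ℤ → ℝ, finalProfile η ms 0 = ∑ w ∈ s, ξ w * η w := by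
  have hle : ∀ {ξ : ℤ → ℝ} {s : Finset ℤ}, (∀ w, 0 ≤ ξ w) → (∀ w ∉ s, ξ w = 0) →
      ∑ w ∈ s, ξ w = 1 → ∀ t : Finset ℤ, ∑ w ∈ t, ξ w ≤ 1 := by
    intro ξ s h0 hs h1 t
    rw [← h1, ← Finset.sum_subset (Finset.inter_subset_left (s₁ := t) (s₂ := s))
      (fun w hw hw' => hs w fun hws => hw' (Finset.mem_inter.2 ⟨hw, hws⟩))]
    exact Finset.sum_le_sum_of_subset_of_nonneg Finset.inter_subset_right fun w _ _ => h0 w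
  have hneg : ∀ {ξ : ℤ → ℝ}, (∀ t : Finset ℤ, ∑ w ∈ t, ξ w ≤ 1) →
      ∀ t : Finset ℤ, ∑ w ∈ t, ξ (-w) ≤ 1 := by
    intro ξ h t
    simpa using h (t.map (Equiv.neg ℤ).toEmbedding)
  induction ms with
  | nil =>
    have hd : HasRightDecay (fun w => if w = 0 then 1 else 0) := by
      intro i j hi hij hj
      have hjR : (0 : ℝ) < j := by exact_mod_cast hj
      have hijR : (i : ℝ) ≤ j := by exact_mod_cast hij
      rw [Finset.sum_ite_eq']
      split_ifs with h
      · have : i = 0 := le_antisymm (Finset.mem_Ico.1 h).1 hi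
        simp [this]
      · rw [sub_nonneg, div_le_one hjR]; exact hijR
    refine ⟨fun w => if w = 0 then 1 else 0, {0}, 0, fun w => by dsimp only; split_ifs <;> norm_num,
      by simp, by simp, ⟨fun w hw => ?_, fun w hw => ?_⟩, hd, by simpa using hd,
      fun η => by simp [finalProfile]⟩
    · dsimp only; rw [if_neg (by omega : w ≠ 0)]; split_ifs <;> norm_num
    · dsimp only; rw [if_neg (by omega : w + 1 ≠ 0)]; split_ifs <;> norm_num
  | cons m ms ih =>
    obtain ⟨ξ, s, c, h0, hs, h1, hc, hr, hl, hη⟩ := ih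
    obtain ⟨k, hk⟩ := m.exists_edgeMove
    obtain ⟨c', hc'⟩ := hc.exists_edgeMove k m.μ_pos m.μ_le
    have hmx : m.x ∈ s ∪ {m.x, m.y} := by simp
    have hmy : m.y ∈ s ∪ {m.x, m.y} := by simp
    have h0' := edgeMove_nonneg (k := k) m.μ_pos m.μ_le h0
    have hs' : ∀ w ∉ s ∪ {m.x, m.y}, edgeMove k m.μ ξ w = 0 := by
      intro w hw
      simp only [Finset.mem_union, Finset.mem_insert, Finset.mem_singleton, not_or] at hw
      rw [← hk, m.apply_of_ne ξ hw.2.1 hw.2.2, hs w hw.1]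
    have hext : ∀ φ : ℤ → ℝ, ∑ w ∈ s, ξ w * φ w = ∑ w ∈ s ∪ {m.x, m.y}, ξ w * φ w := fun φ =>
      Finset.sum_subset Finset.subset_union_left fun w _ hw => by rw [hs w hw, zero_mul]
    -- Self-adjointness shifts the earliest move from the profile to the weights, so the weights
    -- undergo the moves in reverse order.
    have hdual : ∀ φ : ℤ → ℝ, ∑ w ∈ s, ξ w * m.apply φ w =
        ∑ w ∈ s ∪ {m.x, m.y}, edgeMove k m.μ ξ w * φ w := by
      intro φ
      rw [hext, m.sum_apply φ ξ hmx hmy, ← hk]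
      simp only [mul_comm _ (φ _)]
      rw [m.sum_apply ξ φ hmx hmy]
      ring
    have h1' : ∑ w ∈ s ∪ {m.x, m.y}, edgeMove k m.μ ξ w = 1 := by
      have h2 := hdual 1
      have h3 : m.apply (1 : ℤ → ℝ) = 1 := by
        funext w; rw [Move.apply_apply]; simp
      rw [h3] at h2
      simpa [h1, eq_comm] using h2
    have hmass := hle h0' hs' h1'
    refine ⟨edgeMove k m.μ ξ, s ∪ {m.x, m.y}, c', h0', hs', h1', hc',
      hr.edgeMove k m.μ_pos m.μ_le hmass, ?_, fun η => ?_⟩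
    · have hmass' := hneg hmass
      rw [edgeMove_comp_neg]
      refine hl.edgeMove _ m.μ_pos m.μ_le fun t => ?_
      rw [← edgeMove_comp_neg]
      exact hmass' t
    · rw [← hdual]; exact hη _

theorem HasRightDecay.mul_le {ξ : ℤ → ℝ} (h : HasRightDecay ξ) {d : ℤ} (hd : 0 ≤ d) :
    ξ d * (d + 1) ≤ 1 := by
  have h1 := h d (d + 1) hd (by omega) (by omega)
  have hdR : (0 : ℝ) < d + 1 := by exact_mod_cast (by omega : 0 < d + 1)
  rw [sum_int_Ico_add_one] at h1
  push_cast at h1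
  rw [show 1 - (d : ℝ) / (d + 1) = 1 / (d + 1) by field_simp; ring] at h1
  rwa [← le_div_iff₀ hdR]

/-! ### Averaging against unimodal weights. -/

/-- Summation by parts for decreasing weights. -/
theorem neg_mul_le_sum_mul_of_antitone {w x : ℕ → ℝ} (hw : Antitone w) (hw0 : ∀ n, 0 ≤ w n) {E : ℝ}
    (hx : ∀ n, -E ≤ ∑ k ∈ Finset.range n, x k) (n : ℕ) :
    -(E * w 0) ≤ ∑ k ∈ Finset.range n, w k * x k := by
  have key : w n * (∑ k ∈ Finset.range n, x k + E) - E * w 0 ≤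
      ∑ k ∈ Finset.range n, w k * x k := by
    induction n with
    | zero => simp [mul_comm]
    | succ n ih =>
      have h1 := hx (n + 1)
      have h2 := hw (Nat.le_succ n)
      rw [Finset.sum_range_succ] at h1 ⊢
      rw [Finset.sum_range_succ _ n]
      nlinarith
  have := mul_nonneg (hw0 n) (by linarith [hx n] : 0 ≤ ∑ k ∈ Finset.range n, x k + E)
  linarith

theorem sum_Ico_sub_add (f : ℤ → ℝ) (m : ℤ) (N : ℕ) :
    ∑ w ∈ Finset.Ico (m - N) (m + N), f w =
      ∑ k ∈ Finset.range N, f (m + k) + ∑ k ∈ Finset.range N, f (m - 1 - k) := by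
  induction N with
  | zero => simp
  | succ N ih =>
    rw [Finset.sum_range_succ, Finset.sum_range_succ]
    have e1 := sum_int_Ico_consecutive f (show m - ((N + 1 : ℕ) : ℤ) ≤ m - N by omega)
      (show m - (N : ℤ) ≤ m + N by omega)
    have e2 := sum_int_Ico_consecutive f
      (show m - ((N + 1 : ℕ) : ℤ) ≤ m + N by omega)
      (show m + (N : ℤ) ≤ m + ((N + 1 : ℕ) : ℤ) by omega)
    have e3 : Finset.Ico (m - ((N + 1 : ℕ) : ℤ)) (m - N) = {m - 1 - (N : ℤ)} := by
      ext; simp only [Finset.mem_Ico, Finset.mem_singleton]; omega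
    have e4 : Finset.Ico (m + (N : ℤ)) (m + ((N + 1 : ℕ) : ℤ)) = {m + (N : ℤ)} := by
      ext; simp only [Finset.mem_Ico, Finset.mem_singleton]; omega
    rw [e3, Finset.sum_singleton] at e1
    rw [e4, Finset.sum_singleton] at e2
    linarith

/-- A unimodal weight profile averages out a function with controlled interval sums, up to an
error governed by the height and the position of the mode. -/
theorem le_sum_mul_of_isMode {ξ : ℤ → ℝ} {s : Finset ℤ} {m : ℤ} (h0 : ∀ w, 0 ≤ ξ w)
    (hs : ∀ w ∉ s, ξ w = 0) (h1 : ∑ w ∈ s, ξ w = 1) (hm : IsMode ξ m) {θ Θ : ℤ → ℝ}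
    (hΘ : ∀ k, Θ (k + 1) = Θ k + θ k) {β C : ℝ} (hβ : 0 ≤ β)
    (hC : ∀ k : ℤ, |Θ k - k / 2| ≤ β * |(k : ℝ)| + C) :
    1 / 2 - β - 2 * (2 * β * |(m : ℝ)| + 2 * C) * ξ m ≤ ∑ w ∈ s, ξ w * θ w := by
  set E := 2 * β * |(m : ℝ)| + 2 * C with hE
  have hE0 : 0 ≤ E := by
    have := (abs_nonneg _).trans (hC 0)
    simp only [Int.cast_zero, abs_zero, mul_zero, zero_add] at this
    positivity
  have hright : ∀ n : ℕ, ∑ k ∈ Finset.range n, θ (m + k) = Θ (m + n) - Θ m := by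
    intro n
    induction n with
    | zero => simp
    | succ n ih =>
      rw [Finset.sum_range_succ, ih]
      push_cast
      rw [← add_assoc, hΘ]; ring
  have hleft : ∀ n : ℕ, ∑ k ∈ Finset.range n, θ (m - 1 - k) = Θ m - Θ (m - n) := by
    intro n
    induction n with
    | zero => simp
    | succ n ih =>
      have := hΘ (m - 1 - n)
      rw [show m - 1 - (n : ℤ) + 1 = m - n by ring] at this
      rw [Finset.sum_range_succ, ih]
      push_cast
      rw [show m - ((n : ℤ) + 1) = m - 1 - n by ring]
      linarith
  -- Lowering the mean by `β` absorbs the error growing with `n`; only the part depending on `m` and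
  -- `C` remains.
  have hR : ∀ n : ℕ, -E ≤ ∑ k ∈ Finset.range n, (θ (m + k) - (1 / 2 - β)) := by
    intro n
    rw [Finset.sum_sub_distrib, hright]
    have a1 := abs_le.1 (hC (m + n))
    have a2 := abs_le.1 (hC m)
    have a3 : |(m : ℝ) + n| ≤ |(m : ℝ)| + n := by
      simpa using abs_add_le (m : ℝ) n
    push_cast at a1
    simp only [Finset.sum_const, Finset.card_range, nsmul_eq_mul]
    nlinarith [a1.1, a2.2, mul_le_mul_of_nonneg_left a3 hβ]
  have hL : ∀ n : ℕ, -E ≤ ∑ k ∈ Finset.range n, (θ (m - 1 - k) - (1 / 2 - β)) := by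
    intro n
    rw [Finset.sum_sub_distrib, hleft]
    have a1 := abs_le.1 (hC (m - n))
    have a2 := abs_le.1 (hC m)
    have a3 : |(m : ℝ) - n| ≤ |(m : ℝ)| + n := by
      simpa using abs_sub (m : ℝ) n
    push_cast at a1
    simp only [Finset.sum_const, Finset.card_range, nsmul_eq_mul]
    nlinarith [a1.2, a2.1, mul_le_mul_of_nonneg_left a3 hβ]
  obtain ⟨N, hN⟩ : ∃ N : ℕ, ∀ w ∈ s, w ∈ Finset.Ico (m - N) (m + N) := by
    refine ⟨∑ w ∈ s, ((w - m).natAbs + 1), fun w hw => ?_⟩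
    have := Finset.single_le_sum (f := fun w : ℤ => (w - m).natAbs + 1)
      (fun _ _ => Nat.zero_le _) hw
    simp only [Finset.mem_Ico]
    omega
  have hext : ∀ φ : ℤ → ℝ, ∑ w ∈ s, ξ w * φ w =
      ∑ w ∈ Finset.Ico (m - N) (m + N), ξ w * φ w := fun φ =>
    Finset.sum_subset hN fun w _ hw => by rw [hs w hw, zero_mul]
  have hA := neg_mul_le_sum_mul_of_antitone (w := fun k : ℕ => ξ (m + k))
    (antitone_nat_of_succ_le fun n => by
      have := hm.2 (m + n) (by omega)
      push_cast; rwa [← add_assoc]) (fun _ => h0 _) hR N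
  have hB := neg_mul_le_sum_mul_of_antitone (w := fun k : ℕ => ξ (m - 1 - k))
    (antitone_nat_of_succ_le fun n => by
      have := hm.1 (m - 1 - (n + 1 : ℕ)) (by omega)
      rwa [show m - 1 - ((n + 1 : ℕ) : ℤ) + 1 = m - 1 - n by push_cast; ring] at this)
    (fun _ => h0 _) hL N
  have hsum : ∑ w ∈ s, ξ w * (θ w - (1 / 2 - β)) =
      ∑ w ∈ s, ξ w * θ w - (1 / 2 - β) := by
    simp only [mul_sub, Finset.sum_sub_distrib, ← Finset.sum_mul, h1]; ring
  rw [hext, sum_Ico_sub_add] at hsum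
  have := mul_le_mul_of_nonneg_left (hm.le (m - 1)) hE0
  simp only [Nat.cast_zero, add_zero, sub_zero] at hA hB
  linarith

theorem exists_abs_sub_le_of_tendsto {A : ℕ → ℝ} {c : ℝ}
    (h : Tendsto (fun n : ℕ => A n / n) atTop (𝓝 c)) {β : ℝ} (hβ : 0 < β) :
    ∃ C, 0 ≤ C ∧ ∀ n : ℕ, |A n - n * c| ≤ β * n + C := by
  obtain ⟨N, hN⟩ := Metric.tendsto_atTop.1 h β hβ
  refine ⟨∑ n ∈ Finset.range (N + 1), |A n - n * c|, Finset.sum_nonneg fun _ _ => abs_nonneg _,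
    fun n => ?_⟩
  rcases lt_or_ge n (N + 1) with hn | hn
  · have := Finset.single_le_sum (f := fun n : ℕ => |A n - n * c|) (fun _ _ => abs_nonneg _)
      (Finset.mem_range.2 hn)
    have : 0 ≤ β * n := by positivity
    linarith
  · have hn0 : (0 : ℝ) < n := by exact_mod_cast (by omega : 0 < n)
    have h1 := hN n (by omega)
    rw [Real.dist_eq] at h1
    have h2 : A n - n * c = (A n / n - c) * n := by field_simp
    have h3 : 0 ≤ ∑ n ∈ Finset.range (N + 1), |A n - n * c| :=
      Finset.sum_nonneg fun _ _ => abs_nonneg _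
    rw [h2, abs_mul, abs_of_pos hn0]
    nlinarith

/-- On the two-sided infinite path, the achievable levels stay away from one if the empirical
averages in both directions converge to one half. -/
theorem exists_finalProfile_le {η : ℤ → ℝ} (hη : ∀ w, η w < 1)
    (hr : Tendsto (fun n : ℕ => (∑ k ∈ Finset.range n, η k) / n) atTop (𝓝 (1 / 2)))
    (hl : Tendsto (fun n : ℕ => (∑ k ∈ Finset.range n, η (-1 - k)) / n) atTop (𝓝 (1 / 2))) :
    ∃ c < 1, ∀ ms : List (Move intPath), finalProfile η ms 0 ≤ c := by
  obtain ⟨C₁, hC₁, h₁⟩ := exists_abs_sub_le_of_tendsto hr (β := 1 / 20) (by norm_num)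
  obtain ⟨C₂, hC₂, h₂⟩ := exists_abs_sub_le_of_tendsto hl (β := 1 / 20) (by norm_num)
  set C := C₁ + C₂ with hCdef
  let θ : ℤ → ℝ := fun k => 1 - η k
  let Θ : ℤ → ℝ := fun z => ∑ k ∈ Finset.range z.toNat, θ k -
    ∑ k ∈ Finset.range (-z).toNat, θ (-1 - k)
  have hΘ : ∀ k, Θ (k + 1) = Θ k + θ k := by
    intro k
    rcases lt_or_ge k 0 with hk | hk
    · obtain ⟨n, rfl⟩ : ∃ n : ℕ, k = -1 - n := ⟨(-1 - k).toNat, by omega⟩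
      simp only [Θ]
      rw [show (-1 - (n : ℤ) + 1).toNat = 0 by omega, show (-1 - (n : ℤ)).toNat = 0 by omega,
        show (-(-1 - (n : ℤ) + 1)).toNat = n by omega,
        show (-(-1 - (n : ℤ))).toNat = n + 1 by omega, Finset.sum_range_succ]
      ring
    · obtain ⟨n, rfl⟩ := Int.eq_ofNat_of_zero_le hk
      simp only [Θ]
      rw [show ((n : ℤ) + 1).toNat = n + 1 by omega, show (n : ℤ).toNat = n by omega,
        show (-((n : ℤ) + 1)).toNat = 0 by omega, show (-(n : ℤ)).toNat = 0 by omega,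
        Finset.sum_range_succ]
      ring
  have hΘC : ∀ k : ℤ, |Θ k - k / 2| ≤ 1 / 20 * |(k : ℝ)| + C := by
    intro k
    rcases le_total 0 k with hk | hk
    · obtain ⟨n, rfl⟩ := Int.eq_ofNat_of_zero_le hk
      have := h₁ n
      simp only [Θ, θ]
      rw [show (n : ℤ).toNat = n by omega, show (-(n : ℤ)).toNat = 0 by omega,
        Finset.range_zero, Finset.sum_empty]
      simp only [sub_zero, Finset.sum_sub_distrib,
        Finset.sum_const, Finset.card_range, nsmul_eq_mul, Int.cast_natCast, Nat.abs_cast]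
      rw [abs_sub_comm] at this
      rw [show (n : ℝ) * 1 - ∑ k ∈ Finset.range n, η k - n / 2 =
        n * (1 / 2) - ∑ k ∈ Finset.range n, η k by ring]
      linarith
    · obtain ⟨n, rfl⟩ : ∃ n : ℕ, k = -n := ⟨(-k).toNat, by omega⟩
      have := h₂ n
      simp only [Θ, θ]
      rw [show (-(n : ℤ)).toNat = 0 by omega, show (-(-(n : ℤ))).toNat = n by omega,
        Finset.range_zero, Finset.sum_empty]
      simp only [zero_sub, Finset.sum_sub_distrib,
        Finset.sum_const, Finset.card_range, nsmul_eq_mul, Int.cast_natCast, Int.cast_neg, abs_neg,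
        Nat.abs_cast]
      rw [show -((n : ℝ) * 1 - ∑ k ∈ Finset.range n, η (-1 - k)) - -n / 2 =
        ∑ k ∈ Finset.range n, η (-1 - k) - n * (1 / 2) by ring]
      linarith
  have hCpos : 0 ≤ C := by positivity
  -- With `β = 1 / 20` and `ξ m * |m| ≤ 1`, a height `ξ m ≤ h₀` leaves at least `9 / 20 - 1 / 5 - 1
  -- / 8 = 1 / 8`.
  set h₀ : ℝ := 1 / (32 * (C + 1)) with hh₀
  have hh₀pos : 0 < h₀ := by positivity
  obtain ⟨K, hK⟩ := exists_nat_ge (32 * (C + 1))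
  obtain ⟨w₀, -, hw₀⟩ := Finset.exists_min_image (Finset.Icc (-(K : ℤ)) K) θ ⟨0, by simp⟩
  have hθ₀ : 0 < θ w₀ := sub_pos.2 (hη w₀)
  refine ⟨1 - min (1 / 8) (h₀ * θ w₀), ?_, fun ms => ?_⟩
  · have : 0 < min (1 / 8) (h₀ * θ w₀) := by positivity
    linarith
  obtain ⟨ξ, s, m, h0, hs, h1, hm, hR, hL, hval⟩ := exists_weights ms
  have hsum : finalProfile η ms 0 = 1 - ∑ w ∈ s, ξ w * θ w := by
    simp only [hval, θ, mul_sub, mul_one, Finset.sum_sub_distrib, h1]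
    ring
  have hheight : ξ m * (|(m : ℝ)| + 1) ≤ 1 := by
    rcases le_total 0 m with hm0 | hm0
    · rw [abs_of_nonneg (by exact_mod_cast hm0)]
      exact hR.mul_le hm0
    · rw [abs_of_nonpos (by exact_mod_cast hm0)]
      simpa using hL.mul_le (d := -m) (by omega)
  rw [hsum]
  suffices min (1 / 8) (h₀ * θ w₀) ≤ ∑ w ∈ s, ξ w * θ w by linarith
  have hmain := le_sum_mul_of_isMode h0 hs h1 hm hΘ (by norm_num) hΘC
  have hm1 : ξ m * |(m : ℝ)| ≤ 1 := by linarith [h0 m]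
  rcases le_or_gt (ξ m) h₀ with hsmall | hlarge
  · refine (min_le_left _ _).trans (le_trans ?_ hmain)
    have h2 : C * ξ m ≤ 1 / 32 := by
      have h3 : (C + 1) * ξ m ≤ (C + 1) * h₀ := mul_le_mul_of_nonneg_left hsmall (by positivity)
      have h4 : (C + 1) * h₀ = 1 / 32 := by rw [hh₀]; field_simp
      linarith [h0 m]
    linarith
  -- A height above `h₀` forces `|m| ≤ 1 / h₀ ≤ K`, so the single term at `m` already contributes at
  -- least `h₀ * θ w₀`.
  · refine (min_le_right _ _).trans ?_
    have hmK : |(m : ℝ)| ≤ K := by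
      have h3 : h₀ * |(m : ℝ)| ≤ 1 :=
        (mul_le_mul_of_nonneg_right hlarge.le (abs_nonneg _)).trans hm1
      rw [hh₀, one_div, inv_mul_le_iff₀ (by positivity)] at h3
      linarith
    have hmK' : |m| ≤ (K : ℤ) := by exact_mod_cast hmK
    have hms : m ∈ s := by
      by_contra h
      rw [hs m h] at hlarge
      linarith
    have h3 := Finset.single_le_sum (f := fun w => ξ w * θ w)
      (fun w _ => mul_nonneg (h0 w) (sub_nonneg.2 (hη w).le)) hms
    have h4 := hw₀ m (Finset.mem_Icc.2 (abs_le.1 hmK'))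
    exact (mul_le_mul hlarge.le h4 hθ₀.le (h0 m)).trans h3

/-! ### Transport along isomorphisms and basic properties of the two-sided path. -/

def Move.map {V W : Type*} {G : SimpleGraph V} {H : SimpleGraph W} (f : G ≃g H) (m : Move G) :
    Move H :=
  ⟨f m.x, f m.y, f.map_adj_iff.2 m.adj, m.μ, m.μ_pos, m.μ_le⟩

theorem Move.map_apply {V W : Type*} {G : SimpleGraph V} {H : SimpleGraph W} (f : G ≃g H)
    (m : Move G) (η : W → ℝ) (w : V) :
    (m.map f).apply η (f w) = m.apply (fun u => η (f u)) w := by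
  classical
  simp only [Move.apply_apply, Move.map, f.injective.eq_iff]

theorem finalProfile_map {V W : Type*} {G : SimpleGraph V} {H : SimpleGraph W} (f : G ≃g H)
    (ms : List (Move G)) (η : W → ℝ) (w : V) :
    finalProfile η (ms.map (Move.map f)) (f w) = finalProfile (fun u => η (f u)) ms w := by
  induction ms generalizing η with
  | nil => rfl
  | cons m ms ih =>
    change finalProfile ((m.map f).apply η) (ms.map (Move.map f)) (f w) =
      finalProfile (m.apply fun u => η (f u)) ms w
    rw [ih]
    simp only [Move.map_apply]

def intPathShift (t : ℤ) : intPath ≃g intPath where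
  toEquiv := Equiv.addRight t
  map_rel_iff' := by
    intro a b
    simp only [intPath, Equiv.coe_addRight]
    omega

theorem connected_intPath : intPath.Connected := by
  have key : ∀ n : ℕ, ∀ a : ℤ, intPath.Reachable a (a + n) := by
    intro n a
    induction n with
    | zero => simp
    | succ n ih =>
      refine ih.trans (SimpleGraph.Adj.reachable (Or.inl ?_))
      push_cast; ring
  refine SimpleGraph.connected_iff_exists_forall_reachable _ |>.2 ⟨0, fun w => ?_⟩
  rcases le_total 0 w with h | h
  · obtain ⟨n, rfl⟩ := Int.eq_ofNat_of_zero_le h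
    simpa using key n 0
  · have h1 := key w.natAbs w
    rw [show w + (w.natAbs : ℤ) = 0 by omega] at h1
    exact h1.symm

theorem isQuasiTransitive_intPath : IsQuasiTransitive intPath :=
  ⟨1, fun _ => 0, fun u w _ => ⟨intPathShift (w - u), by simp [intPathShift]⟩⟩

theorem hasBoundedDegree_intPath : HasBoundedDegree intPath := by
  refine ⟨2, fun v => ?_⟩
  have : intPath.neighborSet v ⊆ {v + 1, v - 1} := by
    intro w hw
    rcases (hw : w = v + 1 ∨ v = w + 1) with h | h
    · exact Or.inl h
    · exact Or.inr (show w = v - 1 by omega)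
  exact (Set.encard_le_encard this).trans ((Set.encard_insert_le _ _).trans (by rw [Set.encard_singleton]; norm_num))

/-! ### Random profiles on the two-sided path, and the dichotomy. -/

section Uniform

variable {Ω : Type*} [MeasurableSpace Ω] {P : Measure Ω}

theorem ae_kappa_lt_one [IsProbabilityMeasure P] {V : Type*} {G : SimpleGraph V} [Countable V]
    (f : G ≃g intPath) {η : V → Ω → ℝ} (hm : ∀ u, Measurable (η u))
    (hu : ∀ u, pdf.IsUniform (η u) (Set.Ioo (0 : ℝ) 1) P volume) (hi : iIndepFun η P) (v : V) :
    ∀ᵐ ω ∂P, kappa G (fun u => η u ω) v < 1 := by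
  obtain ⟨g, hg⟩ : ∃ g : G ≃g intPath, g v = 0 :=
    ⟨f.trans (intPathShift (-(f v))), by simp [intPathShift]⟩
  have hbox := ae_all_iff.2 fun u => ae_mem_of_isUniform (hu u)
  have hint : ∀ u, Integrable (fun ω => η u ω) P := fun u =>
    Integrable.of_bound (hm u).aestronglyMeasurable 1
      ((ae_mem_of_isUniform (hu u)).mono fun ω h => by
        rw [Real.norm_eq_abs, abs_of_pos h.1]; exact h.2.le)
  have hr := ae_tendsto_average hm hu hi (u := fun k : ℕ => g.symm (k : ℤ))
    (g.symm.injective.comp Nat.cast_injective) measurable_id (hint _)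
  have hl := ae_tendsto_average hm hu hi (u := fun k : ℕ => g.symm (-1 - (k : ℤ)))
    (g.symm.injective.comp fun a b h => by simpa using h) measurable_id (hint _)
  simp only [id_eq, integral_of_isUniform (hu _)] at hr hl
  filter_upwards [hbox, hr, hl] with ω hω hr hl
  obtain ⟨c, hc1, hc⟩ := exists_finalProfile_le (η := fun z => η (g.symm z) ω)
    (fun z => (hω _).2) hr hl
  refine (kappa_le (η := fun u => η u ω) (hω v).1.le fun ms => ?_).trans_lt hc1
  have := finalProfile_map g ms (fun z => η (g.symm z) ω) v
  rw [hg] at this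
  simp only [RelIso.symm_apply_apply] at this
  rw [← this]
  exact hc _

theorem not_ae_kappa_eq_const [IsProbabilityMeasure P] {V : Type*} {G : SimpleGraph V}
    [Countable V] {η : V → Ω → ℝ}
    (hu : ∀ u, pdf.IsUniform (η u) (Set.Ioo (0 : ℝ) 1) P volume) {v : V}
    (hlt : ∀ᵐ ω ∂P, kappa G (fun u => η u ω) v < 1) :
    ¬ ∃ c : ℝ, ∀ᵐ ω ∂P, kappa G (fun u => η u ω) v = c := by
  rintro ⟨c, hc⟩
  have hbox := ae_all_iff.2 fun u => ae_mem_of_isUniform (hu u)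
  have hle : ∀ᵐ ω ∂P, η v ω ≤ c ∧ 0 < c ∧ c < 1 := by
    filter_upwards [hc, hlt, hbox] with ω h1 h2 h3
    have h4 : η v ω ≤ kappa G (fun u => η u ω) v :=
      finalProfile_le_kappa (η := fun u => η u ω) (fun w => Set.Ioo_subset_Icc_self (h3 w)) v []
    rw [h1] at h2 h4
    exact ⟨h4, (h3 v).1.trans_le h4, h2⟩
  obtain ⟨ω, -, h0, h1⟩ := hle.exists
  -- The midpoint of `c` and `1` lies strictly above `c`, yet the uniform law gives its upper tail
  -- positive mass.
  have hz : P (η v ⁻¹' Set.Ici ((c + 1) / 2)) = 0 := by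
    refine measure_mono_null (fun ω hω => ?_) hle
    intro h
    have : (c + 1) / 2 ≤ η v ω := hω
    linarith [h.1]
  rw [measure_ge_of_isUniform (hu v) (by linarith), ENNReal.ofReal_eq_zero] at hz
  linarith

end Uniform

/-- On every infinite connected quasi-transitive graph of bounded degree other than the two-sided
infinite path, the supremum of achievable levels is one. -/
theorem ae_kappa_eq_one_of_not_iso {V : Type*} [Infinite V] {G : SimpleGraph V}
    (hc : G.Connected) (hb : HasBoundedDegree G) (hq : IsQuasiTransitive G)
    (hG : ¬ Nonempty (G ≃g intPath)) {Ω : Type*} [MeasurableSpace Ω] {P : Measure Ω}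
    [IsProbabilityMeasure P] {η : V → Ω → ℝ} (hm : ∀ u, Measurable (η u))
    (hu : ∀ u, pdf.IsUniform (η u) (Set.Ioo (0 : ℝ) 1) P volume) (hi : iIndepFun η P) (v : V) :
    ∀ᵐ ω ∂P, kappa G (fun u => η u ω) v = 1 := by
  have hf := hb.finite_neighborSet
  have := countable_of_connected hc hf
  obtain ⟨r, rfl, hadj, hd⟩ := exists_geodesic_ray hc hf v
  by_cases hB : ∃ x, IsBranching G x
  · obtain ⟨x, hx⟩ := hB
    obtain ⟨R, hR⟩ := hq.exists_dist_le (B := IsBranching G) (fun f _ h => h.map f) hx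
    obtain ⟨M, f, u, hfM, hur, huinj, hfu⟩ := exists_side_neighbors hc hd hR
    exact ae_kappa_eq_one hm hu hi (injective_of_dist hd) hadj hfM hur huinj hfu
  · exact absurd (nonempty_iso_intPath hc
      (fun x y h => existsUnique_other_neighbor hc hf hq (not_exists.1 hB) h) (hadj 0)) hG

end WaterTransport

theorem corollary3p3 :
    (WaterTransport.intPath.Connected ∧
      WaterTransport.IsQuasiTransitive WaterTransport.intPath ∧
      WaterTransport.HasBoundedDegree WaterTransport.intPath) ∧
    ∀ (V : Type*) (_ : Infinite V) (G : SimpleGraph V),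
      G.Connected → WaterTransport.HasBoundedDegree G → WaterTransport.IsQuasiTransitive G →
      ∀ (Ω : Type*) (_ : MeasurableSpace Ω) (P : MeasureTheory.Measure Ω)
        (_ : MeasureTheory.IsProbabilityMeasure P) (η : V → Ω → ℝ),
        (∀ u, Measurable (η u)) →
        (∀ u, MeasureTheory.pdf.IsUniform (η u) (Set.Ioo (0 : ℝ) 1) P MeasureTheory.volume) →
        ProbabilityTheory.iIndepFun η P →
        ∀ v : V,
          ((¬ ∃ c : ℝ, ∀ᵐ ω ∂P, WaterTransport.kappa G (fun u => η u ω) v = c) ↔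
            Nonempty (G ≃g WaterTransport.intPath)) := by
  refine ⟨⟨WaterTransport.connected_intPath, WaterTransport.isQuasiTransitive_intPath,
    WaterTransport.hasBoundedDegree_intPath⟩, ?_⟩
  intro V _ G hc hb hq Ω _ P _ η hm hu hi v
  refine ⟨fun h => ?_, ?_⟩
  · by_contra hG
    exact h ⟨1, WaterTransport.ae_kappa_eq_one_of_not_iso hc hb hq hG hm hu hi v⟩
  · rintro ⟨f⟩
    have := WaterTransport.countable_of_connected hc hb.finite_neighborSet
    exact WaterTransport.not_ae_kappa_eq_const hu (WaterTransport.ae_kappa_lt_one f hm hu hi v)
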